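/- Let $|i\rangle|j\rangle|k\rangle$ denote the computational basis of the three-qubit space $\mathbb{C}^2_A\otimes\mathbb{C}^2_B\otimes\mathbb{C}^2_C$, and let $\mathcal{U}$ be the set of the five mutually orthogonal vectors $$|0\rangle(|00\rangle-2|10\rangle+|11\rangle),\quad (|01\rangle+2|00\rangle-3|10\rangle)|0\rangle,\quad |1\rangle(|01\rangle+|10\rangle),\quad (|00\rangle+|11\rangle)|1\rangle,$$ $$|\kappa\rangle=(|0\rangle+|1\rangle)_B\otimes(|00\rangle+|01\rangle+|10\rangle-|11\rangle)_{CA}$$ (tensor factors in the order $A,B,C$ unless indicated by subscripts). Then the subspace spanned by $\mathcal{U}$ is locally indistinguishable: no orthogonal basis of $\operatorname{span}\mathcal{U}$ can be perfectly distinguished by LOCC. That is, for no orthogonal basis $\psi_1,\dots,\psi_n$ of this subspace is there a protocol, consisting of finitely many rounds in each of which one of the three parties $A,B,C$ performs a measurement (with finitely many outcomes, given by Kraus operators) on its own system and broadcasts the outcome, with the choice of party and measurement depending on all earlier outcomes, which, when the shared state is the normalised $\psi_i$, announces the label $i$ with probability one, for every $i$. -/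

import Mathlib

/-- Pure (not necessarily normalised) states of three parties `A`, `B`, `C` whose local Hilbert
spaces are `ℂ^a`, `ℂ^b`, `ℂ^c`; the entry at `(i, j, k)` is the amplitude of `|i⟩|j⟩|k⟩`. -/
abbrev TriState (a b c : ℕ) : Type := EuclideanSpace ℂ (Fin a × Fin b × Fin c)

namespace TriState

/-- The vector `(K ⊗ I ⊗ I) ψ`. -/
noncomputable def applyA {a b c a' : ℕ} (K : Matrix (Fin a') (Fin a) ℂ) (ψ : TriState a b c) :
    TriState a' b c :=
  WithLp.toLp 2 (fun s => ∑ i, K s.1 i * ψ (i, s.2.1, s.2.2))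

/-- The vector `(I ⊗ K ⊗ I) ψ`. -/
noncomputable def applyB {a b c b' : ℕ} (K : Matrix (Fin b') (Fin b) ℂ) (ψ : TriState a b c) :
    TriState a b' c :=
  WithLp.toLp 2 (fun s => ∑ j, K s.2.1 j * ψ (s.1, j, s.2.2))

/-- The vector `(I ⊗ I ⊗ K) ψ`. -/
noncomputable def applyC {a b c c' : ℕ} (K : Matrix (Fin c') (Fin c) ℂ) (ψ : TriState a b c) :
    TriState a b c' :=
  WithLp.toLp 2 (fun s => ∑ k, K s.2.2 k * ψ (s.1, s.2.1, k))

end TriState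

/-- LOCC discrimination protocols for three parties with local dimensions `a`, `b`, `c`, ending
with the announcement of one of `n` labels. In each round one party performs an arbitrary local
measurement, given by finitely many Kraus operators `K x` with `∑ x, (K x)ᴴ * K x = 1`, and
broadcasts the outcome `x`; everything that follows may depend on all outcomes obtained so far.
The output space of a Kraus operator may have any dimension, so local ancillas, local unitaries and
discarding of local systems are included, as is local or shared randomness (Kraus operators that
are multiples of the identity). The number of rounds is finite but otherwise arbitrary. -/
inductive LOCCProtocol (n : ℕ) : ℕ → ℕ → ℕ → Type
  | announce {a b c : ℕ} (k : Fin n) : LOCCProtocol n a b c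
  | measureA {a b c m : ℕ} (a' : Fin m → ℕ) (K : ∀ x, Matrix (Fin (a' x)) (Fin a) ℂ)
      (complete : ∑ x, (K x).conjTranspose * K x = 1)
      (next : ∀ x, LOCCProtocol n (a' x) b c) : LOCCProtocol n a b c
  | measureB {a b c m : ℕ} (b' : Fin m → ℕ) (K : ∀ x, Matrix (Fin (b' x)) (Fin b) ℂ)
      (complete : ∑ x, (K x).conjTranspose * K x = 1)
      (next : ∀ x, LOCCProtocol n a (b' x) c) : LOCCProtocol n a b c
  | measureC {a b c m : ℕ} (c' : Fin m → ℕ) (K : ∀ x, Matrix (Fin (c' x)) (Fin c) ℂ)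
      (complete : ∑ x, (K x).conjTranspose * K x = 1)
      (next : ∀ x, LOCCProtocol n a b (c' x)) : LOCCProtocol n a b c

namespace LOCCProtocol

/-- The probability that the protocol, run on the unit vector `ψ`, announces the label `j`.
On an arbitrary vector `ψ` this is the probability multiplied by `‖ψ‖ ^ 2`. -/
noncomputable def weight {n : ℕ} : {a b c : ℕ} → LOCCProtocol n a b c → TriState a b c → Fin n → ℝ
  | _, _, _, announce k, ψ, j => if j = k then ‖ψ‖ ^ 2 else 0
  | _, _, _, measureA _ K _ next, ψ, j => ∑ x, weight (next x) (TriState.applyA (K x) ψ) j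
  | _, _, _, measureB _ K _ next, ψ, j => ∑ x, weight (next x) (TriState.applyB (K x) ψ) j
  | _, _, _, measureC _ K _ next, ψ, j => ∑ x, weight (next x) (TriState.applyC (K x) ψ) j

/-- The protocol perfectly distinguishes the states `ψ i` (up to normalisation): when the state is
`ψ i`, the label `i` is announced with probability one. -/
def PerfectlyDistinguishes {n a b c : ℕ} (P : LOCCProtocol n a b c) (ψ : Fin n → TriState a b c) :
    Prop :=
  ∀ i, P.weight (ψ i) i = ‖ψ i‖ ^ 2

end LOCCProtocol

/-- A family of states can be perfectly distinguished by LOCC. -/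
def PerfectlyLOCCDistinguishable {n a b c : ℕ} (ψ : Fin n → TriState a b c) : Prop :=
  ∃ P : LOCCProtocol n a b c, P.PerfectlyDistinguishes ψ

/-- `ψ` is an orthogonal basis of the subspace `V`. -/
structure IsOrthogonalBasisOf {n a b c : ℕ} (ψ : Fin n → TriState a b c)
    (V : Submodule ℂ (TriState a b c)) : Prop where
  ne_zero : ∀ i, ψ i ≠ 0
  orthogonal : ∀ i j, i ≠ j → inner ℂ (ψ i) (ψ j) = 0
  span_eq : Submodule.span ℂ (Set.range ψ) = V

/-- A subspace is locally indistinguishable if none of its orthogonal bases can be perfectly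
distinguished by LOCC. -/
def IsLocallyIndistinguishable {a b c : ℕ} (V : Submodule ℂ (TriState a b c)) : Prop :=
  ∀ (n : ℕ) (ψ : Fin n → TriState a b c), IsOrthogonalBasisOf ψ V →
    ¬ PerfectlyLOCCDistinguishable ψ

namespace ThreeQubit

/-- The computational basis vector `|i⟩_A |j⟩_B |k⟩_C` of three qubits. -/
noncomputable def ket (i j k : Fin 2) : TriState 2 2 2 := EuclideanSpace.single (i, j, k) 1

/-- `|0⟩ (|00⟩ - 2 |10⟩ + |11⟩)` -/
noncomputable def phi0 : TriState 2 2 2 := ket 0 0 0 - (2 : ℂ) • ket 0 1 0 + ket 0 1 1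

/-- `(|01⟩ + 2 |00⟩ - 3 |10⟩) |0⟩` -/
noncomputable def phi1 : TriState 2 2 2 :=
  ket 0 1 0 + (2 : ℂ) • ket 0 0 0 - (3 : ℂ) • ket 1 0 0

/-- `|1⟩ (|01⟩ + |10⟩)` -/
noncomputable def psi0 : TriState 2 2 2 := ket 1 0 1 + ket 1 1 0

/-- `(|00⟩ + |11⟩) |1⟩` -/
noncomputable def psi1 : TriState 2 2 2 := ket 0 0 1 + ket 1 1 1

/-- `(|0⟩ + |1⟩)_B (|00⟩ + |01⟩ + |10⟩ - |11⟩)_{CA}`, the sum over the value `j` of the `B` qubit. -/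
noncomputable def kappa : TriState 2 2 2 :=
  ∑ j : Fin 2, (ket 0 j 0 + ket 1 j 0 + ket 0 j 1 - ket 1 j 1)

/-- The five states of the unextendible biseparable basis. -/
noncomputable def UBB : Set (TriState 2 2 2) := {phi0, phi1, psi0, psi1, kappa}

end ThreeQubit

/-! Every branch of a perfect protocol must keep the states orthogonal. Multiplying the Kraus
operators along a branch gives product effects on the original three qubits (`Distinguishing`), and
`⟨ψ i, E ψ j⟩ = 0` for `i ≠ j` at every node. The other ingredient is unextendibility: no nonzero
vector orthogonal to the span is a product across a bipartition
(`eq_zero_of_orthogonal_of_localOp_eq_zero`).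

At the first non-scalar measurement, by party `p`, subtract an eigenvalue from an effect to get a
singular Hermitian `R`. The images of the five or more states under `R` are pairwise orthogonal in a
space of dimension at most 4, so `R` kills some `ψ k`; likewise `R.adjugate` kills some `ψ l`. These
two states are products across `p` against the rest, with orthogonal factors at `p`
(`exists_product_pair`).

Such a state is an eigenvector of later effects: the residual of its Rayleigh quotient is orthogonal
to all states and still a product, hence zero. So a non-scalar effect of another party makes the
state a product across a second cut. If the other parties never act, an effect of `p` alone isolates
one state, which unextendibility forbids (`exists_other_annihilator`, `localOp_eq_zero`).

Hence both states are fully product. The factor at `p` of a fully product vector in the span is a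
zero of a real binary sextic (`sextic_eq_zero`), and no such sextic vanishes at two orthogonal
vectors (`eq_zero_of_sextic_eq_zero`). -/

namespace TriState

/-! ### Algebra of local operators in arbitrary dimensions -/

section Basic

variable {a b c a' b' c' d : ℕ}

theorem applyA_add (K : Matrix (Fin a') (Fin a) ℂ) (x y : TriState a b c) :
    applyA K (x + y) = applyA K x + applyA K y := by
  ext s; simp [applyA, mul_add, Finset.sum_add_distrib]

theorem applyB_add (K : Matrix (Fin b') (Fin b) ℂ) (x y : TriState a b c) :
    applyB K (x + y) = applyB K x + applyB K y := by
  ext s; simp [applyB, mul_add, Finset.sum_add_distrib]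

theorem applyC_add (K : Matrix (Fin c') (Fin c) ℂ) (x y : TriState a b c) :
    applyC K (x + y) = applyC K x + applyC K y := by
  ext s; simp [applyC, mul_add, Finset.sum_add_distrib]

theorem applyA_zero (K : Matrix (Fin a') (Fin a) ℂ) :
    applyA K (0 : TriState a b c) = 0 := by
  ext s; simp [applyA]

theorem applyB_zero (K : Matrix (Fin b') (Fin b) ℂ) :
    applyB K (0 : TriState a b c) = 0 := by
  ext s; simp [applyB]

theorem applyC_zero (K : Matrix (Fin c') (Fin c) ℂ) :
    applyC K (0 : TriState a b c) = 0 := by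
  ext s; simp [applyC]

theorem applyA_smul (K : Matrix (Fin a') (Fin a) ℂ) (r : ℂ) (x : TriState a b c) :
    applyA K (r • x) = r • applyA K x := by
  ext s; simp [applyA, Finset.mul_sum, mul_left_comm]

theorem applyB_smul (K : Matrix (Fin b') (Fin b) ℂ) (r : ℂ) (x : TriState a b c) :
    applyB K (r • x) = r • applyB K x := by
  ext s; simp [applyB, Finset.mul_sum, mul_left_comm]

theorem applyC_smul (K : Matrix (Fin c') (Fin c) ℂ) (r : ℂ) (x : TriState a b c) :
    applyC K (r • x) = r • applyC K x := by
  ext s; simp [applyC, Finset.mul_sum, mul_left_comm]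

theorem add_applyA (K L : Matrix (Fin a') (Fin a) ℂ) (x : TriState a b c) :
    applyA (K + L) x = applyA K x + applyA L x := by
  ext s; simp [applyA, add_mul, Finset.sum_add_distrib]

theorem add_applyB (K L : Matrix (Fin b') (Fin b) ℂ) (x : TriState a b c) :
    applyB (K + L) x = applyB K x + applyB L x := by
  ext s; simp [applyB, add_mul, Finset.sum_add_distrib]

theorem add_applyC (K L : Matrix (Fin c') (Fin c) ℂ) (x : TriState a b c) :
    applyC (K + L) x = applyC K x + applyC L x := by
  ext s; simp [applyC, add_mul, Finset.sum_add_distrib]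

theorem smul_applyA (r : ℂ) (K : Matrix (Fin a') (Fin a) ℂ) (x : TriState a b c) :
    applyA (r • K) x = r • applyA K x := by
  ext s; simp [applyA, Finset.mul_sum, mul_assoc]

theorem smul_applyB (r : ℂ) (K : Matrix (Fin b') (Fin b) ℂ) (x : TriState a b c) :
    applyB (r • K) x = r • applyB K x := by
  ext s; simp [applyB, Finset.mul_sum, mul_assoc]

theorem smul_applyC (r : ℂ) (K : Matrix (Fin c') (Fin c) ℂ) (x : TriState a b c) :
    applyC (r • K) x = r • applyC K x := by
  ext s; simp [applyC, Finset.mul_sum, mul_assoc]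

theorem sum_applyA {ι : Type*} (t : Finset ι) (K : ι → Matrix (Fin a') (Fin a) ℂ)
    (x : TriState a b c) : applyA (∑ k ∈ t, K k) x = ∑ k ∈ t, applyA (K k) x :=
  map_sum (AddMonoidHom.mk' (fun L => applyA L x) fun L L' => add_applyA L L' x) K t

theorem sum_applyB {ι : Type*} (t : Finset ι) (K : ι → Matrix (Fin b') (Fin b) ℂ)
    (x : TriState a b c) : applyB (∑ k ∈ t, K k) x = ∑ k ∈ t, applyB (K k) x :=
  map_sum (AddMonoidHom.mk' (fun L => applyB L x) fun L L' => add_applyB L L' x) K t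

theorem sum_applyC {ι : Type*} (t : Finset ι) (K : ι → Matrix (Fin c') (Fin c) ℂ)
    (x : TriState a b c) : applyC (∑ k ∈ t, K k) x = ∑ k ∈ t, applyC (K k) x :=
  map_sum (AddMonoidHom.mk' (fun L => applyC L x) fun L L' => add_applyC L L' x) K t

theorem one_applyA (x : TriState a b c) : applyA 1 x = x := by
  ext s; simp [applyA, Matrix.one_apply]

theorem one_applyB (x : TriState a b c) : applyB 1 x = x := by
  ext s; simp [applyB, Matrix.one_apply]

theorem one_applyC (x : TriState a b c) : applyC 1 x = x := by
  ext s; simp [applyC, Matrix.one_apply]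

theorem mul_applyA (K : Matrix (Fin d) (Fin a') ℂ) (L : Matrix (Fin a') (Fin a) ℂ)
    (x : TriState a b c) : applyA (K * L) x = applyA K (applyA L x) := by
  ext s
  simp only [applyA, Matrix.mul_apply, Finset.sum_mul, Finset.mul_sum, mul_assoc]
  exact Finset.sum_comm

theorem mul_applyB (K : Matrix (Fin d) (Fin b') ℂ) (L : Matrix (Fin b') (Fin b) ℂ)
    (x : TriState a b c) : applyB (K * L) x = applyB K (applyB L x) := by
  ext s
  simp only [applyB, Matrix.mul_apply, Finset.sum_mul, Finset.mul_sum, mul_assoc]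
  exact Finset.sum_comm

theorem mul_applyC (K : Matrix (Fin d) (Fin c') ℂ) (L : Matrix (Fin c') (Fin c) ℂ)
    (x : TriState a b c) : applyC (K * L) x = applyC K (applyC L x) := by
  ext s
  simp only [applyC, Matrix.mul_apply, Finset.sum_mul, Finset.mul_sum, mul_assoc]
  exact Finset.sum_comm

theorem applyA_applyB (K : Matrix (Fin a') (Fin a) ℂ) (L : Matrix (Fin b') (Fin b) ℂ)
    (x : TriState a b c) : applyA K (applyB L x) = applyB L (applyA K x) := by
  ext s
  simp only [applyA, applyB, Finset.mul_sum]
  rw [Finset.sum_comm]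
  simp only [mul_left_comm]

theorem applyA_applyC (K : Matrix (Fin a') (Fin a) ℂ) (L : Matrix (Fin c') (Fin c) ℂ)
    (x : TriState a b c) : applyA K (applyC L x) = applyC L (applyA K x) := by
  ext s
  simp only [applyA, applyC, Finset.mul_sum]
  rw [Finset.sum_comm]
  simp only [mul_left_comm]

theorem applyB_applyC (K : Matrix (Fin b') (Fin b) ℂ) (L : Matrix (Fin c') (Fin c) ℂ)
    (x : TriState a b c) : applyB K (applyC L x) = applyC L (applyB K x) := by
  ext s
  simp only [applyB, applyC, Finset.mul_sum]
  rw [Finset.sum_comm]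
  simp only [mul_left_comm]

theorem inner_applyA (K : Matrix (Fin a') (Fin a) ℂ) (x : TriState a b c) (y : TriState a' b c) :
    inner ℂ (applyA K x) y = inner ℂ x (applyA K.conjTranspose y) := by
  simp only [PiLp.inner_apply, applyA, RCLike.inner_apply, map_sum, map_mul, Finset.mul_sum,
    Finset.sum_mul, Fintype.sum_prod_type_right (γ := ℂ) (α₁ := Fin a),
    Fintype.sum_prod_type_right (γ := ℂ) (α₁ := Fin a'), Matrix.conjTranspose_apply,
    starRingEnd_apply]
  refine Finset.sum_congr rfl fun i _ => ?_
  rw [Finset.sum_comm]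
  simp only [mul_left_comm, mul_comm, mul_assoc]

theorem inner_applyB (K : Matrix (Fin b') (Fin b) ℂ) (x : TriState a b c) (y : TriState a b' c) :
    inner ℂ (applyB K x) y = inner ℂ x (applyB K.conjTranspose y) := by
  simp only [PiLp.inner_apply, applyB, RCLike.inner_apply, map_sum, map_mul, Finset.mul_sum,
    Finset.sum_mul, Fintype.sum_prod_type, Matrix.conjTranspose_apply, starRingEnd_apply]
  refine Finset.sum_congr rfl fun i _ => ?_
  simp only [Finset.sum_comm (s := (Finset.univ : Finset (Fin c)))]
  rw [Finset.sum_comm]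
  simp only [mul_left_comm, mul_comm, mul_assoc]

theorem inner_applyC (K : Matrix (Fin c') (Fin c) ℂ) (x : TriState a b c) (y : TriState a b c') :
    inner ℂ (applyC K x) y = inner ℂ x (applyC K.conjTranspose y) := by
  simp only [PiLp.inner_apply, applyC, RCLike.inner_apply, map_sum, map_mul, Finset.mul_sum,
    Finset.sum_mul, Fintype.sum_prod_type, Matrix.conjTranspose_apply, starRingEnd_apply]
  refine Finset.sum_congr rfl fun i _ => Finset.sum_congr rfl fun j _ => ?_
  rw [Finset.sum_comm]
  simp only [mul_left_comm, mul_comm, mul_assoc]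

theorem sum_norm_applyA {m : ℕ} {d : Fin m → ℕ} (K : ∀ k, Matrix (Fin (d k)) (Fin a) ℂ)
    (hK : ∑ k, (K k).conjTranspose * K k = 1) (x : TriState a b c) :
    ∑ k, ‖applyA (K k) x‖ ^ 2 = ‖x‖ ^ 2 := by
  have h : ∑ k, inner ℂ (applyA (K k) x) (applyA (K k) x) = inner ℂ x x := by
    simp only [inner_applyA, ← mul_applyA]
    rw [← inner_sum, ← sum_applyA, hK, one_applyA]
  simp only [inner_self_eq_norm_sq_to_K] at h
  exact_mod_cast h

theorem sum_norm_applyB {m : ℕ} {d : Fin m → ℕ} (K : ∀ k, Matrix (Fin (d k)) (Fin b) ℂ)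
    (hK : ∑ k, (K k).conjTranspose * K k = 1) (x : TriState a b c) :
    ∑ k, ‖applyB (K k) x‖ ^ 2 = ‖x‖ ^ 2 := by
  have h : ∑ k, inner ℂ (applyB (K k) x) (applyB (K k) x) = inner ℂ x x := by
    simp only [inner_applyB, ← mul_applyB]
    rw [← inner_sum, ← sum_applyB, hK, one_applyB]
  simp only [inner_self_eq_norm_sq_to_K] at h
  exact_mod_cast h

theorem sum_norm_applyC {m : ℕ} {d : Fin m → ℕ} (K : ∀ k, Matrix (Fin (d k)) (Fin c) ℂ)
    (hK : ∑ k, (K k).conjTranspose * K k = 1) (x : TriState a b c) :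
    ∑ k, ‖applyC (K k) x‖ ^ 2 = ‖x‖ ^ 2 := by
  have h : ∑ k, inner ℂ (applyC (K k) x) (applyC (K k) x) = inner ℂ x x := by
    simp only [inner_applyC, ← mul_applyC]
    rw [← inner_sum, ← sum_applyC, hK, one_applyC]
  simp only [inner_self_eq_norm_sq_to_K] at h
  exact_mod_cast h

end Basic

/-! ### Operators on three qubits, indexed by the party -/

/-- The operators acting on the qubit of party `A`, `B` or `C` (numbered `0`, `1`, `2`). -/
noncomputable def localOp : Fin 3 → Matrix (Fin 2) (Fin 2) ℂ →ₐ[ℂ] Module.End ℂ (TriState 2 2 2) :=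
  ![AlgHom.ofLinearMap
      (LinearMap.mk₂ ℂ applyA add_applyA smul_applyA applyA_add fun r K x => applyA_smul K r x)
      (LinearMap.ext one_applyA) (fun K L => LinearMap.ext (mul_applyA K L)),
    AlgHom.ofLinearMap
      (LinearMap.mk₂ ℂ applyB add_applyB smul_applyB applyB_add fun r K x => applyB_smul K r x)
      (LinearMap.ext one_applyB) (fun K L => LinearMap.ext (mul_applyB K L)),
    AlgHom.ofLinearMap
      (LinearMap.mk₂ ℂ applyC add_applyC smul_applyC applyC_add fun r K x => applyC_smul K r x)
      (LinearMap.ext one_applyC) (fun K L => LinearMap.ext (mul_applyC K L))]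

theorem localOp_zero (K : Matrix (Fin 2) (Fin 2) ℂ) (x : TriState 2 2 2) :
    localOp 0 K x = applyA K x := rfl

theorem localOp_one (K : Matrix (Fin 2) (Fin 2) ℂ) (x : TriState 2 2 2) :
    localOp 1 K x = applyB K x := rfl

theorem localOp_two (K : Matrix (Fin 2) (Fin 2) ℂ) (x : TriState 2 2 2) :
    localOp 2 K x = applyC K x := rfl

theorem inner_localOp (p : Fin 3) (K : Matrix (Fin 2) (Fin 2) ℂ) (x y : TriState 2 2 2) :
    inner ℂ (localOp p K x) y = inner ℂ x (localOp p K.conjTranspose y) := by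
  fin_cases p
  exacts [inner_applyA K x y, inner_applyB K x y, inner_applyC K x y]

theorem localOp_comm {p q : Fin 3} (h : p ≠ q) (K L : Matrix (Fin 2) (Fin 2) ℂ)
    (x : TriState 2 2 2) : localOp p K (localOp q L x) = localOp q L (localOp p K x) := by
  fin_cases p <;> fin_cases q <;> first | exact absurd rfl h | skip
  exacts [applyA_applyB K L x, applyA_applyC K L x, (applyA_applyB L K x).symm,
    applyB_applyC K L x, (applyA_applyC L K x).symm, (applyB_applyC L K x).symm]

/-- The product operator `E 0 ⊗ E 1 ⊗ E 2`. -/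
noncomputable def jointOp (E : Fin 3 → Matrix (Fin 2) (Fin 2) ℂ) : Module.End ℂ (TriState 2 2 2) :=
  localOp 0 (E 0) * localOp 1 (E 1) * localOp 2 (E 2)

theorem jointOp_apply (E : Fin 3 → Matrix (Fin 2) (Fin 2) ℂ) {p q r : Fin 3} (hpq : p ≠ q)
    (hpr : p ≠ r) (hqr : q ≠ r) (x : TriState 2 2 2) :
    jointOp E x = localOp p (E p) (localOp q (E q) (localOp r (E r) x)) := by
  have h01 := localOp_comm (show (0 : Fin 3) ≠ 1 by decide) (E 0) (E 1)
  have h02 := localOp_comm (show (0 : Fin 3) ≠ 2 by decide) (E 0) (E 2)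
  have h12 := localOp_comm (show (1 : Fin 3) ≠ 2 by decide) (E 1) (E 2)
  simp only [jointOp, Module.End.mul_apply]
  fin_cases p <;> fin_cases q <;> first | exact absurd rfl hpq | skip
  all_goals fin_cases r <;> first | exact absurd rfl hpr | exact absurd rfl hqr | skip
  all_goals simp [h01, h02, h12]

end TriState

/-! ### Branches of a perfect protocol -/

namespace LOCCProtocol

theorem weight_le {n a b c : ℕ} (P : LOCCProtocol n a b c) (ψ : TriState a b c) (j : Fin n) :
    P.weight ψ j ≤ ‖ψ‖ ^ 2 := by
  induction P with
  | announce k =>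
    rw [weight]; split_ifs
    · exact le_rfl
    · positivity
  | measureA d K hK next ih =>
    rw [weight, ← TriState.sum_norm_applyA K hK]
    exact Finset.sum_le_sum fun x _ => ih x _
  | measureB d K hK next ih =>
    rw [weight, ← TriState.sum_norm_applyB K hK]
    exact Finset.sum_le_sum fun x _ => ih x _
  | measureC d K hK next ih =>
    rw [weight, ← TriState.sum_norm_applyC K hK]
    exact Finset.sum_le_sum fun x _ => ih x _

/-- The weight of the correct label is bounded in each branch by the squared norm of the branch
vector, and these norms add up to the total; equality of the sums forces equality in every branch.
-/
theorem PerfectlyDistinguishes.nextA {n a b c m : ℕ} {d : Fin m → ℕ}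
    {K : ∀ x, Matrix (Fin (d x)) (Fin a) ℂ} {hK : ∑ x, (K x).conjTranspose * K x = 1}
    {next : ∀ x, LOCCProtocol n (d x) b c} {ψ : Fin n → TriState a b c}
    (h : (measureA d K hK next).PerfectlyDistinguishes ψ) (x : Fin m) :
    (next x).PerfectlyDistinguishes fun i => TriState.applyA (K x) (ψ i) := by
  intro i
  have h1 := h i
  rw [weight, ← TriState.sum_norm_applyA K hK] at h1
  exact (Finset.sum_eq_sum_iff_of_le fun y _ => weight_le _ _ i).1 h1 x (Finset.mem_univ x)

theorem PerfectlyDistinguishes.nextB {n a b c m : ℕ} {d : Fin m → ℕ}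
    {K : ∀ x, Matrix (Fin (d x)) (Fin b) ℂ} {hK : ∑ x, (K x).conjTranspose * K x = 1}
    {next : ∀ x, LOCCProtocol n a (d x) c} {ψ : Fin n → TriState a b c}
    (h : (measureB d K hK next).PerfectlyDistinguishes ψ) (x : Fin m) :
    (next x).PerfectlyDistinguishes fun i => TriState.applyB (K x) (ψ i) := by
  intro i
  have h1 := h i
  rw [weight, ← TriState.sum_norm_applyB K hK] at h1
  exact (Finset.sum_eq_sum_iff_of_le fun y _ => weight_le _ _ i).1 h1 x (Finset.mem_univ x)

theorem PerfectlyDistinguishes.nextC {n a b c m : ℕ} {d : Fin m → ℕ}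
    {K : ∀ x, Matrix (Fin (d x)) (Fin c) ℂ} {hK : ∑ x, (K x).conjTranspose * K x = 1}
    {next : ∀ x, LOCCProtocol n a b (d x)} {ψ : Fin n → TriState a b c}
    (h : (measureC d K hK next).PerfectlyDistinguishes ψ) (x : Fin m) :
    (next x).PerfectlyDistinguishes fun i => TriState.applyC (K x) (ψ i) := by
  intro i
  have h1 := h i
  rw [weight, ← TriState.sum_norm_applyC K hK] at h1
  exact (Finset.sum_eq_sum_iff_of_le fun y _ => weight_le _ _ i).1 h1 x (Finset.mem_univ x)

end LOCCProtocol

/-! ### From protocols to product effects -/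

open TriState

/-- The product effects `E 0 ⊗ E 1 ⊗ E 2` that can be refined, by successive local measurements
on three qubits, to effects each of which annihilates all but one of the states `ψ i`. -/
inductive Distinguishing {n : ℕ} (ψ : Fin n → TriState 2 2 2) :
    (Fin 3 → Matrix (Fin 2) (Fin 2) ℂ) → Prop
  | announce (E : Fin 3 → Matrix (Fin 2) (Fin 2) ℂ) (k : Fin n)
      (annihilates : ∀ i, i ≠ k → jointOp E (ψ i) = 0)
      (orthogonal : ∀ i j, i ≠ j → inner ℂ (ψ i) (jointOp E (ψ j)) = 0) : Distinguishing ψ E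
  | measure (E : Fin 3 → Matrix (Fin 2) (Fin 2) ℂ) (p : Fin 3) {m : ℕ}
      (F : Fin m → Matrix (Fin 2) (Fin 2) ℂ) (hermitian : ∀ x, (F x).IsHermitian)
      (complete : ∑ x, F x = E p) (next : ∀ x, Distinguishing ψ (Function.update E p (F x))) :
      Distinguishing ψ E

theorem exists_other_parties : ∀ p : Fin 3, ∃ q r : Fin 3, p ≠ q ∧ p ≠ r ∧ q ≠ r := by decide

theorem exists_third_party : ∀ p q : Fin 3, p ≠ q → ∃ r : Fin 3, p ≠ r ∧ q ≠ r := by decide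

namespace Distinguishing

/-- An effect is the sum of its refinements, so orthogonality propagates from the leaves up to every
node. -/
theorem orthogonal {n : ℕ} {ψ : Fin n → TriState 2 2 2} {E : Fin 3 → Matrix (Fin 2) (Fin 2) ℂ}
    (h : Distinguishing ψ E) {i j : Fin n} (hij : i ≠ j) :
    inner ℂ (ψ i) (jointOp E (ψ j)) = 0 := by
  induction h with
  | announce E k h1 h2 => exact h2 i j hij
  | measure E p F hF hc next ih =>
    obtain ⟨q, r, hpq, hpr, hqr⟩ := exists_other_parties p
    simp only [jointOp_apply _ hpq hpr hqr, Function.update_self, Function.update_of_ne hpq.symm,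
      Function.update_of_ne hpr.symm] at ih ⊢
    rw [← hc, map_sum, LinearMap.sum_apply, inner_sum]
    exact Finset.sum_eq_zero fun x _ => ih x

end Distinguishing

/-- `A`, `B`, `C` accumulate the Kraus operators applied so far. Passing to `KᴴK` pulls everything
back to the original qubits, whatever the output dimensions. -/
theorem LOCCProtocol.PerfectlyDistinguishes.distinguishing {n : ℕ} {ψ : Fin n → TriState 2 2 2}
    {a b c : ℕ} (P : LOCCProtocol n a b c) (A : Matrix (Fin a) (Fin 2) ℂ)
    (B : Matrix (Fin b) (Fin 2) ℂ) (C : Matrix (Fin c) (Fin 2) ℂ)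
    (h : P.PerfectlyDistinguishes fun i => applyA A (applyB B (applyC C (ψ i)))) :
    Distinguishing ψ ![A.conjTranspose * A, B.conjTranspose * B, C.conjTranspose * C] := by
  induction P with
  | announce k =>
    have hz : ∀ i, i ≠ k → applyA A (applyB B (applyC C (ψ i))) = 0 := by
      intro i hik
      have := h i
      simpa [weight, hik] using this.symm
    have hE : ∀ x, jointOp ![A.conjTranspose * A, B.conjTranspose * B, C.conjTranspose * C] x
        = applyC C.conjTranspose (applyB B.conjTranspose (applyA A.conjTranspose
          (applyA A (applyB B (applyC C x))))) := by
      intro x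
      simp [jointOp, localOp_zero, localOp_one, localOp_two, mul_applyA, mul_applyB, mul_applyC,
        applyA_applyB, applyA_applyC, applyB_applyC]
    have h0 : ∀ i, i ≠ k → jointOp ![A.conjTranspose * A, B.conjTranspose * B,
        C.conjTranspose * C] (ψ i) = 0 := by
      intro i hik
      rw [hE, hz i hik, applyA_zero, applyB_zero, applyC_zero]
    refine .announce _ k h0 fun i j hij => ?_
    -- For `j = k` the effect does not kill `ψ j`; half of it is moved to the left argument, where
    -- `ψ i` is killed.
    by_cases hj : j = k
    · rw [hE, ← inner_applyC, ← inner_applyB, ← inner_applyA, hz i (hj ▸ hij), inner_zero_left]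
    · rw [h0 j hj, inner_zero_right]
  | measureA d K hK next ih =>
    refine .measure _ 0 (fun x => (K x * A).conjTranspose * (K x * A))
      (fun x => Matrix.isHermitian_conjTranspose_mul_self _) ?_ fun x => ?_
    · simp only [Matrix.conjTranspose_mul, Matrix.mul_assoc]
      simp only [← Matrix.mul_assoc (K _).conjTranspose]
      rw [← Matrix.mul_sum, ← Matrix.sum_mul, hK, Matrix.one_mul]; rfl
    · convert ih x (K x * A) B C ?_ using 1
      · ext q; fin_cases q <;> rfl
      · simpa only [mul_applyA] using h.nextA x
  | measureB d K hK next ih =>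
    refine .measure _ 1 (fun x => (K x * B).conjTranspose * (K x * B))
      (fun x => Matrix.isHermitian_conjTranspose_mul_self _) ?_ fun x => ?_
    · simp only [Matrix.conjTranspose_mul, Matrix.mul_assoc]
      simp only [← Matrix.mul_assoc (K _).conjTranspose]
      rw [← Matrix.mul_sum, ← Matrix.sum_mul, hK, Matrix.one_mul]; rfl
    · convert ih x A (K x * B) C ?_ using 1
      · ext q; fin_cases q <;> rfl
      · simpa only [mul_applyB, applyA_applyB] using h.nextB x
  | measureC d K hK next ih =>
    refine .measure _ 2 (fun x => (K x * C).conjTranspose * (K x * C))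
      (fun x => Matrix.isHermitian_conjTranspose_mul_self _) ?_ fun x => ?_
    · simp only [Matrix.conjTranspose_mul, Matrix.mul_assoc]
      simp only [← Matrix.mul_assoc (K _).conjTranspose]
      rw [← Matrix.mul_sum, ← Matrix.sum_mul, hK, Matrix.one_mul]; rfl
    · convert ih x A B (K x * C) ?_ using 1
      · ext q; fin_cases q <;> rfl
      · simpa only [mul_applyC, applyA_applyC, applyB_applyC] using h.nextC x

/-! ### Two-by-two matrices and ranges of local operators -/

namespace TriState

theorem adjugate_ne_zero_fin_two {R : Matrix (Fin 2) (Fin 2) ℂ} (h : R ≠ 0) : R.adjugate ≠ 0 := by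
  intro hK
  apply h
  have h2 := congrArg Matrix.adjugate hK
  rw [Matrix.adjugate_fin_two, Matrix.adjugate_fin_two] at h2
  ext i j
  have h3 := congrFun (congrFun h2 i) j
  fin_cases i <;> fin_cases j <;> simpa using h3

/-- If `G` annihilates a state, then `G'` annihilates its image under `K`: a local operator keeps a
product across its own cut a product. Generically `G' = G * K.adjugate`; if that is zero, `K` is
singular and `K.adjugate` or `1` serves. -/
theorem exists_mul_eq_smul_fin_two {G : Matrix (Fin 2) (Fin 2) ℂ} (hG : G ≠ 0)
    (K : Matrix (Fin 2) (Fin 2) ℂ) :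
    ∃ G' : Matrix (Fin 2) (Fin 2) ℂ, G' ≠ 0 ∧ ∃ r : ℂ, G' * K = r • G := by
  by_cases h : G * K.adjugate = 0
  · have hdet : K.det = 0 := by
      have h1 : K.det • G = 0 := by
        rw [← Matrix.mul_one G, ← Matrix.mul_smul, ← Matrix.adjugate_mul, ← Matrix.mul_assoc, h,
          Matrix.zero_mul]
      exact (smul_eq_zero.1 h1).resolve_right hG
    by_cases hK : K = 0
    · exact ⟨1, one_ne_zero, 0, by simp [hK]⟩
    · exact ⟨K.adjugate, adjugate_ne_zero_fin_two hK, 0, by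
        rw [Matrix.adjugate_mul, hdet, zero_smul, zero_smul]⟩
  · exact ⟨G * K.adjugate, h, K.det, by
      rw [Matrix.mul_assoc, Matrix.adjugate_mul, Matrix.mul_smul, Matrix.mul_one]⟩

theorem localOp_smul_one (p : Fin 3) (r : ℂ) (x : TriState 2 2 2) :
    localOp p (r • (1 : Matrix (Fin 2) (Fin 2) ℂ)) x = r • x := by
  rw [map_smul, map_one]; rfl

theorem localOp_mul_apply (p : Fin 3) (K L : Matrix (Fin 2) (Fin 2) ℂ) (x : TriState 2 2 2) :
    localOp p (K * L) x = localOp p K (localOp p L x) := by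
  rw [map_mul]; rfl

/-- No nonzero vector is a simultaneous eigenvector of all operators on one of the qubits. -/
theorem eq_zero_of_forall_localOp_eq_smul (p : Fin 3) {z : TriState 2 2 2}
    (h : ∀ X, ∃ r : ℂ, localOp p X z = r • z) : z = 0 := by
  -- A nilpotent has only the eigenvalue zero, and the identity is a combination of products of the
  -- two nilpotent matrix units.
  have nil : ∀ X : Matrix (Fin 2) (Fin 2) ℂ, X * X = 0 → localOp p X z = 0 := by
    intro X hX
    obtain ⟨r, hr⟩ := h X
    have h1 : (r * r) • z = 0 := by
      rw [mul_smul, ← hr, ← map_smul, ← hr, ← localOp_mul_apply, hX, map_zero]; rfl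
    rw [hr]
    rcases smul_eq_zero.1 h1 with h2 | h2
    · rw [mul_self_eq_zero.1 h2, zero_smul]
    · rw [h2, smul_zero]
  have h1 := nil !![0, 1; 0, 0] (by ext i j; fin_cases i <;> fin_cases j <;> simp)
  have h2 := nil !![0, 0; 1, 0] (by ext i j; fin_cases i <;> fin_cases j <;> simp)
  have h3 : (1 : Matrix (Fin 2) (Fin 2) ℂ)
      = !![0, 1; 0, 0] * !![0, 0; 1, 0] + !![0, 0; 1, 0] * !![0, 1; 0, 0] := by
    ext i j; fin_cases i <;> fin_cases j <;> simp
  have h4 : localOp p (1 : Matrix (Fin 2) (Fin 2) ℂ) z = z := by rw [map_one]; rfl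
  rw [← h4, h3, map_add, LinearMap.add_apply, localOp_mul_apply, localOp_mul_apply, h1, h2,
    map_zero, map_zero, add_zero]

theorem finrank_range_localOp_le (p : Fin 3) {R : Matrix (Fin 2) (Fin 2) ℂ} (h : R.det = 0) :
    Module.finrank ℂ (LinearMap.range (localOp p R)) ≤ 4 := by
  obtain ⟨v, hv, hRv⟩ := Matrix.exists_mulVec_eq_zero_iff.2 h
  obtain ⟨i₀, hi₀⟩ : ∃ i, v i ≠ 0 := Function.ne_iff.1 hv
  have hRv' : ∀ i, ∑ j, R i j * v j = 0 := fun i => congrFun hRv i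
  suffices H : ∃ f : (Fin 2 × Fin 2 → ℂ) →ₗ[ℂ] TriState 2 2 2, Function.Injective f ∧
      ∀ e, localOp p R (f e) = 0 by
    obtain ⟨f, hf, h0⟩ := H
    have h1 : LinearMap.range f ≤ LinearMap.ker (localOp p R) := by
      rintro _ ⟨e, rfl⟩; exact h0 e
    have h2 := Submodule.finrank_mono h1
    rw [LinearMap.finrank_range_of_inj hf] at h2
    have h3 := LinearMap.finrank_range_add_finrank_ker (localOp p R)
    simp at h2 h3
    omega
  -- The kernel contains `v ⊗ e` for all `e`, a four-dimensional family. Here `u` reads the index of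
  -- the party, `g` the other two, and `t` is a section of `g` at the index `i₀` where `v` is
  -- nonzero.
  have key : ∀ (u : Fin 2 × Fin 2 × Fin 2 → Fin 2) (g : Fin 2 × Fin 2 × Fin 2 → Fin 2 × Fin 2)
      (t : Fin 2 × Fin 2 → Fin 2 × Fin 2 × Fin 2), (∀ x, u (t x) = i₀) → (∀ x, g (t x) = x) →
      (∀ e : Fin 2 × Fin 2 → ℂ, localOp p R (WithLp.toLp 2 fun s => v (u s) * e (g s)) = 0) →
      ∃ f : (Fin 2 × Fin 2 → ℂ) →ₗ[ℂ] TriState 2 2 2, Function.Injective f ∧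
      ∀ e, localOp p R (f e) = 0 := by
    intro u g t hu hg h0
    refine ⟨
      { toFun := fun e => WithLp.toLp 2 fun s => v (u s) * e (g s)
        map_add' := ?_
        map_smul' := ?_ }, ?_, h0⟩
    · intro e e'; ext s; simp [mul_add]
    · intro r e; ext s; simp [mul_left_comm]
    · intro e e' he
      ext1 x
      have h1 := congrArg (fun w : TriState 2 2 2 => w (t x)) he
      simpa [hu, hg, hi₀] using h1
  fin_cases p
  · refine key (fun s => s.1) (fun s => s.2) (fun x => (i₀, x)) (fun _ => rfl) (fun _ => rfl) ?_
    intro e; ext s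
    simpa [localOp_zero, applyA, ← Finset.sum_mul, ← mul_assoc] using Or.inl (hRv' s.1)
  · refine key (fun s => s.2.1) (fun s => (s.1, s.2.2)) (fun x => (x.1, i₀, x.2)) (fun _ => rfl)
      (fun _ => rfl) ?_
    intro e; ext s
    simpa [localOp_one, applyB, ← Finset.sum_mul, ← mul_assoc] using Or.inl (hRv' s.2.1)
  · refine key (fun s => s.2.2) (fun s => (s.1, s.2.1)) (fun x => (x.1, x.2, i₀)) (fun _ => rfl)
      (fun _ => rfl) ?_
    intro e; ext s
    simpa [localOp_two, applyC, ← Finset.sum_mul, ← mul_assoc] using Or.inl (hRv' s.2.2)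

end TriState

/-! ### Consequences of unextendibility -/

/-- The orthogonal complement of the states `ψ i` contains no nonzero vector that is a product
across one of the three bipartitions. -/
def UnextendibleBiseparably {n : ℕ} (ψ : Fin n → TriState 2 2 2) : Prop :=
  ∀ (p : Fin 3) (G : Matrix (Fin 2) (Fin 2) ℂ), G ≠ 0 → ∀ χ : TriState 2 2 2,
    (∀ i, inner ℂ (ψ i) χ = 0) → localOp p G χ = 0 → χ = 0

section

variable {n : ℕ} {ψ : Fin n → TriState 2 2 2}

/-- With `r` the Rayleigh quotient, the residual is orthogonal to every state, including `ψ k`, and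
`hb` makes it a product; so it vanishes. -/
theorem UnextendibleBiseparably.exists_eigenvalue (hψ : UnextendibleBiseparably ψ)
    (ho : ∀ i j, i ≠ j → inner ℂ (ψ i) (ψ j) = 0) {k : Fin n} (hk : ψ k ≠ 0)
    (X : Module.End ℂ (TriState 2 2 2)) (hX : ∀ i, i ≠ k → inner ℂ (ψ i) (X (ψ k)) = 0)
    (p : Fin 3) (hb : ∀ r : ℂ, ∃ G, G ≠ 0 ∧ localOp p G (X (ψ k) - r • ψ k) = 0) :
    ∃ r : ℂ, X (ψ k) = r • ψ k := by
  refine ⟨inner ℂ (ψ k) (X (ψ k)) / inner ℂ (ψ k) (ψ k), ?_⟩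
  obtain ⟨G, hG, h⟩ := hb (inner ℂ (ψ k) (X (ψ k)) / inner ℂ (ψ k) (ψ k))
  refine sub_eq_zero.1 (hψ p G hG _ (fun i => ?_) h)
  rw [inner_sub_right, inner_smul_right]
  by_cases hi : i = k
  · subst hi
    rw [div_mul_cancel₀ _ (inner_self_ne_zero.2 hk), sub_self]
  · rw [hX i hi, ho i k hi, mul_zero, sub_zero]

theorem UnextendibleBiseparably.exists_eigenvalue_same (hψ : UnextendibleBiseparably ψ)
    (ho : ∀ i j, i ≠ j → inner ℂ (ψ i) (ψ j) = 0) {k : Fin n} (hk : ψ k ≠ 0) {p : Fin 3}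
    {G : Matrix (Fin 2) (Fin 2) ℂ} (hG : G ≠ 0) (hGk : localOp p G (ψ k) = 0)
    (F : Matrix (Fin 2) (Fin 2) ℂ) (hF : ∀ i, i ≠ k → inner ℂ (ψ i) (localOp p F (ψ k)) = 0) :
    ∃ r : ℂ, localOp p F (ψ k) = r • ψ k := by
  refine hψ.exists_eigenvalue ho hk _ hF p fun r => ?_
  obtain ⟨G', hG', s, hs⟩ := exists_mul_eq_smul_fin_two hG (F - r • 1)
  refine ⟨G', hG', ?_⟩
  rw [← localOp_smul_one p r (ψ k), ← LinearMap.sub_apply, ← map_sub, ← localOp_mul_apply, hs,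
    map_smul, LinearMap.smul_apply, hGk, smul_zero]

/-- An operator of party `q` commutes with `G`, so the residual is still annihilated by `G`. -/
theorem UnextendibleBiseparably.exists_eigenvalue_other (hψ : UnextendibleBiseparably ψ)
    (ho : ∀ i j, i ≠ j → inner ℂ (ψ i) (ψ j) = 0) {k : Fin n} (hk : ψ k ≠ 0) {p q : Fin 3}
    (hpq : p ≠ q) {G : Matrix (Fin 2) (Fin 2) ℂ} (hG : G ≠ 0) (hGk : localOp p G (ψ k) = 0)
    (F : Matrix (Fin 2) (Fin 2) ℂ) (hF : ∀ i, i ≠ k → inner ℂ (ψ i) (localOp q F (ψ k)) = 0) :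
    ∃ r : ℂ, localOp q F (ψ k) = r • ψ k := by
  refine hψ.exists_eigenvalue ho hk _ hF p fun r => ⟨G, hG, ?_⟩
  rw [map_sub, map_smul, localOp_comm hpq, hGk, map_zero, smul_zero, sub_zero]

/-- A local operator that annihilates all but one of the states annihilates the last one, too. -/
theorem UnextendibleBiseparably.localOp_eq_zero (hψ : UnextendibleBiseparably ψ)
    (hne : ∀ i, ψ i ≠ 0) {k l : Fin n} (hl : l ≠ k) {p : Fin 3} {R : Matrix (Fin 2) (Fin 2) ℂ}
    (hR : ∀ i, i ≠ k → localOp p R (ψ i) = 0) : localOp p R (ψ k) = 0 := by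
  by_contra hk
  have hR0 : R.conjTranspose ≠ 0 := by
    intro h
    rw [Matrix.conjTranspose_eq_zero] at h
    exact hk (by rw [h, map_zero]; rfl)
  have hdet : R.det = 0 := by
    have h1 : R.det • ψ l = 0 := by
      rw [← localOp_smul_one p, ← Matrix.adjugate_mul, localOp_mul_apply, hR l hl, map_zero]
    exact (smul_eq_zero.1 h1).resolve_right (hne l)
  -- Vectors in the range of `Rᴴ` are products across `p`, being killed by its adjugate, and are
  -- orthogonal to all `ψ i` with `i ≠ k`. So pairing with `ψ k` is injective on this range, which
  -- is at most a line.
  have vanish : ∀ y, inner ℂ (ψ k) (localOp p R.conjTranspose y) = 0 →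
      localOp p R.conjTranspose y = 0 := by
    intro y hy
    refine hψ p _ (adjugate_ne_zero_fin_two hR0) _ (fun i => ?_) ?_
    · by_cases hi : i = k
      · rw [hi, hy]
      · rw [← inner_localOp, hR i hi, inner_zero_left]
    · rw [← localOp_mul_apply, Matrix.adjugate_mul, Matrix.det_conjTranspose, hdet, star_zero,
        zero_smul, map_zero]; rfl
  obtain ⟨q, -, hpq, -, -⟩ := exists_other_parties p
  set y := localOp p R (ψ k) with hy
  have hz : localOp p R.conjTranspose y ≠ 0 := by
    intro h
    have h1 : inner ℂ y y = (0 : ℂ) := by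
      nth_rewrite 1 [hy]
      rw [inner_localOp, h, inner_zero_right]
    exact hk (inner_self_eq_zero.1 h1)
  have hkz : inner ℂ (ψ k) (localOp p R.conjTranspose y) ≠ (0 : ℂ) := fun h => hz (vanish y h)
  -- The range is invariant under operators on another qubit `q`; being at most a line, it would
  -- consist of common eigenvectors of all of them.
  refine hz (eq_zero_of_forall_localOp_eq_smul q fun X => ?_)
  set z := localOp p R.conjTranspose y with hzdef
  refine ⟨inner ℂ (ψ k) (localOp q X z) / inner ℂ (ψ k) z, ?_⟩
  have h1 : localOp q X z - (inner ℂ (ψ k) (localOp q X z) / inner ℂ (ψ k) z) • z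
      = localOp p R.conjTranspose
        (localOp q X y - (inner ℂ (ψ k) (localOp q X z) / inner ℂ (ψ k) z) • y) := by
    rw [map_sub, map_smul, localOp_comm hpq]
  refine sub_eq_zero.1 ?_
  rw [h1]
  refine vanish _ ?_
  rw [← h1, inner_sub_right, inner_smul_right, div_mul_cancel₀ _ hkz, sub_self]

/-- If a state is a product across the bipartition of `p` against the rest and its amplitude is
not lost in a discrimination that starts from an effect of party `p`, then it is a product across
another bipartition as well. -/
theorem Distinguishing.exists_other_annihilator (hψ : UnextendibleBiseparably ψ)
    (hne : ∀ i, ψ i ≠ 0) (ho : ∀ i j, i ≠ j → inner ℂ (ψ i) (ψ j) = 0) (hn : 2 ≤ n)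
    {k : Fin n} {p : Fin 3} {G : Matrix (Fin 2) (Fin 2) ℂ} (hG : G ≠ 0)
    (hGk : localOp p G (ψ k) = 0) {E : Fin 3 → Matrix (Fin 2) (Fin 2) ℂ}
    (h : Distinguishing ψ E) (hp : ∃ r : ℂ, r ≠ 0 ∧ localOp p (E p) (ψ k) = r • ψ k)
    (hq : ∀ q, p ≠ q → ∃ r : ℂ, r ≠ 0 ∧ E q = r • (1 : Matrix (Fin 2) (Fin 2) ℂ)) :
    ∃ q, p ≠ q ∧ ∃ G', G' ≠ 0 ∧ localOp q G' (ψ k) = 0 := by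
  induction h with
  | announce E l h1 h2 =>
    exfalso
    obtain ⟨q, r, hpq, hpr, hqr⟩ := exists_other_parties p
    obtain ⟨s, hs, hsk⟩ := hp
    obtain ⟨t, ht, hEq⟩ := hq q hpq
    obtain ⟨u, hu, hEr⟩ := hq r hpr
    have hEp : ∀ i, i ≠ l → localOp p (E p) (ψ i) = 0 := by
      intro i hi
      have h3 := h1 i hi
      rw [jointOp_apply E hpq hpr hqr, hEq, hEr, localOp_smul_one, localOp_smul_one, map_smul,
        map_smul, smul_smul] at h3
      exact (smul_eq_zero.1 h3).resolve_left (mul_ne_zero ht hu)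
    have hk0 : localOp p (E p) (ψ k) ≠ 0 := by
      rw [hsk]; exact smul_ne_zero hs (hne k)
    obtain rfl : k = l := by
      by_contra hkl; exact hk0 (hEp k hkl)
    have : Nontrivial (Fin n) := Fin.nontrivial_iff_two_le.2 hn
    obtain ⟨i, hi⟩ := exists_ne k
    exact hk0 (hψ.localOp_eq_zero hne hi hEp)
  | measure E p' F hF hc next ih =>
    by_cases hpp : p = p'
    · subst hpp
      obtain ⟨q, r, hpq, hpr, hqr⟩ := exists_other_parties p
      obtain ⟨s, hs, hsk⟩ := hp
      obtain ⟨t, ht, hEq⟩ := hq q hpq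
      obtain ⟨u, hu, hEr⟩ := hq r hpr
      have hev : ∀ x, ∃ c : ℂ, localOp p (F x) (ψ k) = c • ψ k := by
        intro x
        refine hψ.exists_eigenvalue_same ho (hne k) hG hGk _ fun i hi => ?_
        have h3 := (next x).orthogonal hi
        rw [jointOp_apply _ hpq hpr hqr, Function.update_self, Function.update_of_ne hpq.symm,
          Function.update_of_ne hpr.symm, hEq, hEr, localOp_smul_one, localOp_smul_one, map_smul,
          map_smul, smul_smul, inner_smul_right] at h3
        exact (mul_eq_zero.1 h3).resolve_left (mul_ne_zero ht hu)
      choose c hcx using hev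
      -- The eigenvalues of the outcomes sum to the nonzero eigenvalue of `E p`, so some branch
      -- keeps the amplitude of `ψ k`.
      obtain ⟨x, hx⟩ : ∃ x, c x ≠ 0 := by
        by_contra! hall
        rw [← hc, map_sum, LinearMap.sum_apply, Finset.sum_eq_zero] at hsk
        · exact smul_ne_zero hs (hne k) hsk.symm
        · intro x _
          rw [hcx, hall, zero_smul]
      refine ih x ⟨c x, hx, ?_⟩ fun q' hq' => ?_
      · rw [Function.update_self, hcx]
      · rw [Function.update_of_ne hq'.symm]; exact hq q' hq'
    · by_cases hsc : ∀ x, ∃ c : ℂ, F x = c • (1 : Matrix (Fin 2) (Fin 2) ℂ)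
      · choose c hcx using hsc
        obtain ⟨t, ht, hEq⟩ := hq p' hpp
        obtain ⟨x, hx⟩ : ∃ x, c x ≠ 0 := by
          by_contra! hall
          rw [← hc, Finset.sum_eq_zero] at hEq
          · exact smul_ne_zero ht one_ne_zero hEq.symm
          · intro x _
            rw [hcx, hall, zero_smul]
        refine ih x ?_ fun q' hq' => ?_
        · rw [Function.update_of_ne hpp]; exact hp
        · by_cases hqp : q' = p'
          · subst hqp
            rw [Function.update_self]; exact ⟨c x, hx, hcx x⟩
          · rw [Function.update_of_ne hqp]; exact hq q' hq'
      · push Not at hsc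
        obtain ⟨x, hx⟩ := hsc
        obtain ⟨r, hpr, hqr⟩ := exists_third_party p p' hpp
        obtain ⟨s, hs, hsk⟩ := hp
        obtain ⟨u, hu, hEr⟩ := hq r hpr
        obtain ⟨c, hcx⟩ : ∃ c : ℂ, localOp p' (F x) (ψ k) = c • ψ k := by
          refine hψ.exists_eigenvalue_other ho (hne k) hpp hG hGk _ fun i hi => ?_
          have h3 := (next x).orthogonal hi
          rw [jointOp_apply _ (Ne.symm hpp) hqr hpr, Function.update_self,
            Function.update_of_ne hpp, Function.update_of_ne hqr.symm, hEr, localOp_smul_one,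
            map_smul, hsk, map_smul, map_smul, smul_smul, inner_smul_right] at h3
          exact (mul_eq_zero.1 h3).resolve_left (mul_ne_zero hu hs)
        -- A non-scalar effect with `ψ k` as eigenvector gives the second annihilator.
        refine ⟨p', hpp, F x - c • 1, sub_ne_zero.2 (hx c), ?_⟩
        rw [map_sub, LinearMap.sub_apply, localOp_smul_one, hcx, sub_self]

/-! ### The first non-scalar measurement -/

/-- Among at least five states with pairwise orthogonal images under a singular local operator,
one is annihilated. -/
theorem exists_localOp_eq_zero (hn : 5 ≤ n) {p : Fin 3} {R : Matrix (Fin 2) (Fin 2) ℂ}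
    (hR : R.det = 0)
    (ho : ∀ i j, i ≠ j → inner ℂ (localOp p R (ψ i)) (localOp p R (ψ j)) = 0) :
    ∃ i, localOp p R (ψ i) = 0 := by
  by_contra! h
  have h1 : LinearIndependent ℂ fun i => localOp p R (ψ i) :=
    linearIndependent_of_ne_zero_of_inner_eq_zero h fun i j hij => ho i j hij
  have h2 := finrank_span_eq_card h1
  have h3 : Submodule.span ℂ (Set.range fun i => localOp p R (ψ i))
      ≤ LinearMap.range (localOp p R) := by
    rw [Submodule.span_le]
    rintro _ ⟨i, rfl⟩
    exact ⟨_, rfl⟩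
  have h4 := Submodule.finrank_mono h3
  have h5 := finrank_range_localOp_le p hR
  rw [h2, Fintype.card_fin] at h4
  omega

theorem Matrix.IsHermitian.exists_sub_smul_one_det_eq_zero {H : Matrix (Fin 2) (Fin 2) ℂ}
    (hH : H.IsHermitian) :
    ∃ t : ℂ, (H - t • (1 : Matrix (Fin 2) (Fin 2) ℂ)).IsHermitian ∧
      (H - t • (1 : Matrix (Fin 2) (Fin 2) ℂ)).det = 0 := by
  refine ⟨(hH.eigenvalues 0 : ℂ), hH.sub ?_, ?_⟩
  · simp [Matrix.IsHermitian, Matrix.conjTranspose_smul]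
  · refine Matrix.exists_mulVec_eq_zero_iff.1 ⟨hH.eigenvectorBasis 0, ?_, ?_⟩
    · intro h
      exact (hH.eigenvectorBasis.orthonormal.ne_zero 0) (by ext i; exact congrFun h i)
    · rw [Matrix.sub_mulVec, hH.mulVec_eigenvectorBasis, Matrix.smul_mulVec, Matrix.one_mulVec]
      ext i; simp

/-- Cayley–Hamilton. For Hermitian `R` it turns `⟨ψ i, R ψ j⟩ = 0` into orthogonality of the images
`R ψ i`. -/
theorem mul_self_eq_trace_smul_of_det_eq_zero {R : Matrix (Fin 2) (Fin 2) ℂ} (hdet : R.det = 0) :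
    R * R = R.trace • R := by
  rw [Matrix.det_fin_two] at hdet
  ext i j
  fin_cases i <;> fin_cases j <;> simp [Matrix.mul_apply, Matrix.trace_fin_two] <;> grind

theorem adjugate_eq_trace_smul_sub (R : Matrix (Fin 2) (Fin 2) ℂ) :
    R.adjugate = R.trace • 1 - R := by
  rw [Matrix.adjugate_fin_two, Matrix.trace_fin_two]
  ext i j
  fin_cases i <;> fin_cases j <;> simp

/-- If one of the five or more states can be singled out by local measurements, two of them are
fully product, with orthogonal factors for one of the parties. -/
theorem Distinguishing.exists_product_pair (hψ : UnextendibleBiseparably ψ)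
    (hne : ∀ i, ψ i ≠ 0) (ho : ∀ i j, i ≠ j → inner ℂ (ψ i) (ψ j) = 0) (hn : 5 ≤ n)
    {E : Fin 3 → Matrix (Fin 2) (Fin 2) ℂ} (h : Distinguishing ψ E)
    (hE : ∀ q, ∃ r : ℂ, r ≠ 0 ∧ E q = r • (1 : Matrix (Fin 2) (Fin 2) ℂ)) :
    ∃ (p : Fin 3) (R : Matrix (Fin 2) (Fin 2) ℂ), R.IsHermitian ∧ R ≠ 0 ∧ R.det = 0 ∧
      ∃ k l, localOp p R (ψ k) = 0 ∧ localOp p R.adjugate (ψ l) = 0 ∧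
        (∃ q, p ≠ q ∧ ∃ G, G ≠ 0 ∧ localOp q G (ψ k) = 0) ∧
        (∃ q, p ≠ q ∧ ∃ G, G ≠ 0 ∧ localOp q G (ψ l) = 0) := by
  induction h with
  | announce E l h1 h2 =>
    exfalso
    have : Nontrivial (Fin n) := Fin.nontrivial_iff_two_le.2 (by omega)
    obtain ⟨i, hi⟩ := exists_ne l
    choose r hr hEr using hE
    have h3 := h1 i hi
    rw [jointOp_apply E (p := 0) (q := 1) (r := 2) (by decide) (by decide) (by decide), hEr, hEr,
      hEr, localOp_smul_one, localOp_smul_one, localOp_smul_one] at h3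
    exact smul_ne_zero (hr 0) (smul_ne_zero (hr 1) (smul_ne_zero (hr 2) (hne i))) h3
  | measure E p F hF hc next ih =>
    by_cases hsc : ∀ x, ∃ c : ℂ, F x = c • (1 : Matrix (Fin 2) (Fin 2) ℂ)
    · choose c hcx using hsc
      obtain ⟨t, ht, hEq⟩ := hE p
      obtain ⟨x, hx⟩ : ∃ x, c x ≠ 0 := by
        by_contra! hall
        rw [← hc, Finset.sum_eq_zero] at hEq
        · exact smul_ne_zero ht one_ne_zero hEq.symm
        · intro x _
          rw [hcx, hall, zero_smul]
      refine ih x fun q => ?_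
      by_cases hqp : q = p
      · subst hqp
        rw [Function.update_self]; exact ⟨c x, hx, hcx x⟩
      · rw [Function.update_of_ne hqp]; exact hE q
    · push Not at hsc
      obtain ⟨x₀, hx₀⟩ := hsc
      have hdiag : ∀ x i j, i ≠ j → inner ℂ (ψ i) (localOp p (F x) (ψ j)) = 0 := by
        intro x i j hij
        obtain ⟨q, r, hpq, hpr, hqr⟩ := exists_other_parties p
        obtain ⟨t, ht, hEq⟩ := hE q
        obtain ⟨u, hu, hEr⟩ := hE r
        have h3 := (next x).orthogonal hij
        rw [jointOp_apply _ hpq hpr hqr, Function.update_self, Function.update_of_ne hpq.symm,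
          Function.update_of_ne hpr.symm, hEq, hEr, localOp_smul_one, localOp_smul_one, map_smul,
          map_smul, smul_smul, inner_smul_right] at h3
        exact (mul_eq_zero.1 h3).resolve_left (mul_ne_zero ht hu)
      obtain ⟨t, hRh, hRd⟩ := (hF x₀).exists_sub_smul_one_det_eq_zero
      have hR0 : F x₀ - t • 1 ≠ 0 := sub_ne_zero.2 (hx₀ t)
      have hRdiag : ∀ i j, i ≠ j → inner ℂ (ψ i) (localOp p (F x₀ - t • 1) (ψ j)) = 0 := by
        intro i j hij
        rw [map_sub, LinearMap.sub_apply, localOp_smul_one, inner_sub_right, inner_smul_right,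
          hdiag x₀ i j hij, ho i j hij, mul_zero, sub_zero]
      generalize F x₀ - t • (1 : Matrix (Fin 2) (Fin 2) ℂ) = R at hRh hRd hR0 hRdiag
      have hAdiag : ∀ i j, i ≠ j → inner ℂ (ψ i) (localOp p R.adjugate (ψ j)) = 0 := by
        intro i j hij
        rw [adjugate_eq_trace_smul_sub, map_sub, LinearMap.sub_apply, localOp_smul_one,
          inner_sub_right, inner_smul_right, hRdiag i j hij, ho i j hij, mul_zero, sub_zero]
      have hAd : R.adjugate.det = 0 := by
        rw [Matrix.det_adjugate, hRd]; simp
      have killed : ∀ S : Matrix (Fin 2) (Fin 2) ℂ, S.IsHermitian → S.det = 0 →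
          (∀ i j, i ≠ j → inner ℂ (ψ i) (localOp p S (ψ j)) = 0) →
          ∃ i, localOp p S (ψ i) = 0 := by
        intro S hS hSd hSo
        refine exists_localOp_eq_zero hn hSd fun i j hij => ?_
        rw [inner_localOp, hS.eq, ← localOp_mul_apply, mul_self_eq_trace_smul_of_det_eq_zero hSd,
          map_smul, LinearMap.smul_apply, inner_smul_right, hSo i j hij, mul_zero]
      have follow : ∀ S : Matrix (Fin 2) (Fin 2) ℂ, S ≠ 0 → ∀ k, localOp p S (ψ k) = 0 →
          ∃ q, p ≠ q ∧ ∃ G, G ≠ 0 ∧ localOp q G (ψ k) = 0 := by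
        intro S hS k hk
        -- The state is followed from the node before the measurement, where all effects are still
        -- nonzero scalars, and not from the branch `x₀`, where its amplitude might be lost.
        have hm := Distinguishing.measure E p F hF hc next
        refine hm.exists_other_annihilator hψ hne ho (by omega) hS hk ?_ fun q _ => hE q
        obtain ⟨u, hu, hEu⟩ := hE p
        exact ⟨u, hu, by rw [hEu, localOp_smul_one]⟩
      obtain ⟨k, hk⟩ := killed R hRh hRd hRdiag
      obtain ⟨l, hl⟩ := killed R.adjugate (by
        rw [Matrix.IsHermitian, Matrix.adjugate_conjTranspose, hRh.eq]) hAd hAdiag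
      exact ⟨p, R, hRh, hR0, hRd, k, l, hk, hl, follow R hR0 k hk,
        follow _ (adjugate_ne_zero_fin_two hR0) l hl⟩

end

/-! ### The sextics have no pair of orthogonal zeros -/

namespace ThreeQubit

/-- The binary sextic forms whose zeros are the local factors of the product vectors in the span
of `UBB`. -/
noncomputable def sextic : Fin 3 → (Fin 2 → ℂ) → ℂ :=
  ![fun u => 9 * u 0 ^ 6 - 30 * u 0 ^ 5 * u 1 - 87 * u 0 ^ 4 * u 1 ^ 2 -
      132 * u 0 ^ 3 * u 1 ^ 3 - 121 * u 0 ^ 2 * u 1 ^ 4 - 54 * u 0 * u 1 ^ 5 -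
      9 * u 1 ^ 6,
    fun u => -u 0 ^ 6 - 2 * u 0 ^ 5 * u 1 + u 0 ^ 4 * u 1 ^ 2 - 4 * u 0 ^ 3 * u 1 ^ 3 +
      25 * u 0 ^ 2 * u 1 ^ 4 - 26 * u 0 * u 1 ^ 5 - 9 * u 1 ^ 6,
    fun u => 3 * u 0 ^ 6 + 18 * u 0 ^ 5 * u 1 + 39 * u 0 ^ 4 * u 1 ^ 2 +
      44 * u 0 ^ 3 * u 1 ^ 3 + 37 * u 0 ^ 2 * u 1 ^ 4 + 42 * u 0 * u 1 ^ 5 +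
      49 * u 1 ^ 6]

/-- The form and its rotation by a right angle are coprime. The constants are a Bézout certificate:
cofactors of degree 5 against forms of degree 6 produce a multiple of `u 0 ^ 11`. -/
theorem eq_zero_of_sextic_eq_zero (p : Fin 3) (u : Fin 2 → ℂ) (h : sextic p u = 0)
    (h' : sextic p ![-u 1, u 0] = 0) : u 0 = 0 := by
  fin_cases p
  · simp only [sextic, Fin.zero_eta, Matrix.cons_val] at h h'
    have h1 : (37186560 : ℂ) * u 0 ^ 11 = 0 := by
      linear_combination
        (-5412099 * u 0 ^ 5 + 17196287 * u 0 ^ 4 * u 1 - 21041850 * u 0 ^ 3 * u 1 ^ 2 +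
        14986002 * u 0 ^ 2 * u 1 ^ 3 - 5992431 * u 0 * u 1 ^ 4 - 1683333 * u 1 ^ 5) * h +
        (-9543939 * u 0 ^ 5 - 22027017 * u 0 ^ 4 * u 1 - 29894994 * u 0 ^ 3 * u 1 ^ 2 -
        24934550 * u 0 ^ 2 * u 1 ^ 3 - 10481319 * u 0 * u 1 ^ 4 - 1683333 * u 1 ^ 5) * h'
    exact pow_eq_zero_iff (by norm_num) |>.1 ((mul_eq_zero.1 h1).resolve_left (by norm_num))
  · simp only [sextic, Fin.mk_one, Matrix.cons_val] at h h'
    have h1 : (2947200 : ℂ) * u 0 ^ 11 = 0 := by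
      linear_combination
        (-1650687 * u 0 ^ 5 - 1308441 * u 0 ^ 4 * u 1 - 222562 * u 0 ^ 3 * u 1 ^ 2 -
        71712 * u 0 ^ 2 * u 1 ^ 3 - 87291 * u 0 * u 1 ^ 4 + 50149 * u 1 ^ 5) * h +
        (-144057 * u 0 ^ 5 + 96037 * u 0 ^ 4 * u 1 + 9366 * u 0 ^ 3 * u 1 ^ 2 +
        875484 * u 0 ^ 2 * u 1 ^ 3 - 1420937 * u 0 * u 1 ^ 4 - 451341 * u 1 ^ 5) * h'
    exact pow_eq_zero_iff (by norm_num) |>.1 ((mul_eq_zero.1 h1).resolve_left (by norm_num))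
  · simp only [sextic, Fin.reduceFinMk, Matrix.cons_val] at h h'
    have h1 : (137057280 : ℂ) * u 0 ^ 11 = 0 := by
      linear_combination
        (-483951 * u 0 ^ 5 + 1358071 * u 0 ^ 4 * u 1 - 1610986 * u 0 ^ 3 * u 1 ^ 2 +
        1065114 * u 0 ^ 2 * u 1 ^ 3 - 365043 * u 0 * u 1 ^ 4 + 48651 * u 1 ^ 5) * h +
        (2826717 * u 0 ^ 5 + 2517531 * u 0 ^ 4 * u 1 + 8358 * u 0 ^ 3 * u 1 ^ 2 +
        524682 * u 0 ^ 2 * u 1 ^ 3 + 513457 * u 0 * u 1 ^ 4 - 794633 * u 1 ^ 5) * h'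
    exact pow_eq_zero_iff (by norm_num) |>.1 ((mul_eq_zero.1 h1).resolve_left (by norm_num))

end ThreeQubit

/-! ### Products across a bipartition -/

namespace TriState

/-- The product `u ⊗ f` across the bipartition of one party against the other two. -/
noncomputable def biproduct :
    Fin 3 → (Fin 2 → ℂ) → Matrix (Fin 2) (Fin 2) ℂ → TriState 2 2 2 :=
  ![fun u f => WithLp.toLp 2 fun s => u s.1 * f s.2.1 s.2.2,
    fun u f => WithLp.toLp 2 fun s => u s.2.1 * f s.1 s.2.2,
    fun u f => WithLp.toLp 2 fun s => u s.2.2 * f s.1 s.2.1]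

/-- The kernel of a nonzero singular matrix is the line through `u`. The index `i` is independent of
`x`, so that one slice of a state can supply the second tensor factor. -/
theorem exists_forall_eq_mul {R : Matrix (Fin 2) (Fin 2) ℂ} (hR : R ≠ 0) {u : Fin 2 → ℂ}
    (hu : u ≠ 0) (hRu : R.mulVec u = 0) :
    ∃ i, u i ≠ 0 ∧ ∀ x : Fin 2 → ℂ, (∀ a, ∑ b, R a b * x b = 0) → ∀ b, x b = u b * (x i / u i) := by
  obtain ⟨i, hi⟩ : ∃ i, u i ≠ 0 := Function.ne_iff.1 hu
  obtain ⟨a, ha⟩ : ∃ a, R a ≠ 0 := Function.ne_iff.1 hR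
  obtain ⟨b, hb⟩ : ∃ b, R a b ≠ 0 := Function.ne_iff.1 ha
  refine ⟨i, hi, fun x hx => ?_⟩
  have h1 := hx a
  have h2 : ∑ b, R a b * u b = 0 := congrFun hRu a
  rw [Fin.sum_univ_two] at h1 h2
  intro c
  field_simp
  fin_cases i <;> fin_cases b <;> fin_cases c <;> simp at * <;> grind

theorem exists_eq_biproduct {p : Fin 3} {R : Matrix (Fin 2) (Fin 2) ℂ} (hR : R ≠ 0)
    {u : Fin 2 → ℂ} (hu : u ≠ 0) (hRu : R.mulVec u = 0) {ψ : TriState 2 2 2}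
    (h : localOp p R ψ = 0) : ∃ f, ψ = biproduct p u f := by
  obtain ⟨i, hi, H⟩ := exists_forall_eq_mul hR hu hRu
  fin_cases p
  · refine ⟨Matrix.of fun j k => ψ (i, j, k) / u i, ?_⟩
    ext ⟨a, j, k⟩
    refine H (fun a => ψ (a, j, k)) (fun a => ?_) a
    exact congrArg (fun w : TriState 2 2 2 => w (a, j, k)) h
  · refine ⟨Matrix.of fun j k => ψ (j, i, k) / u i, ?_⟩
    ext ⟨j, a, k⟩
    refine H (fun a => ψ (j, a, k)) (fun a => ?_) a
    exact congrArg (fun w : TriState 2 2 2 => w (j, a, k)) h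
  · refine ⟨Matrix.of fun j k => ψ (j, k, i) / u i, ?_⟩
    ext ⟨j, k, a⟩
    refine H (fun a => ψ (j, k, a)) (fun a => ?_) a
    exact congrArg (fun w : TriState 2 2 2 => w (j, k, a)) h

theorem det_eq_zero_of_mul_eq_zero {G f : Matrix (Fin 2) (Fin 2) ℂ} (hG : G ≠ 0)
    (h : G * f = 0) : f.det = 0 := by
  have h1 : f.det • G = 0 := by
    rw [← Matrix.mul_one G, ← Matrix.mul_smul, ← Matrix.mul_adjugate, ← Matrix.mul_assoc, h,
      Matrix.zero_mul]
  exact (smul_eq_zero.1 h1).resolve_right hG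

theorem biproduct_zero (p : Fin 3) (u : Fin 2 → ℂ) : biproduct p u 0 = 0 := by
  ext s
  fin_cases p <;> simp [biproduct]

/-- A slice of the product at an index `i` with `u i ≠ 0` is a nonzero multiple of `f`; depending on
the parties, `G` acts on its rows or its columns. -/
theorem det_eq_zero_of_localOp_biproduct_eq_zero {p q : Fin 3} (hpq : p ≠ q) {u : Fin 2 → ℂ}
    (hu : u ≠ 0) {f G : Matrix (Fin 2) (Fin 2) ℂ} (hG : G ≠ 0)
    (h : localOp q G (biproduct p u f) = 0) : f.det = 0 := by
  obtain ⟨i, hi⟩ : ∃ i, u i ≠ 0 := Function.ne_iff.1 hu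
  have hs : ∀ s, localOp q G (biproduct p u f) s = 0 := fun s => by rw [h]; rfl
  have left : (∀ j k, ∑ l, G j l * (u i * f l k) = 0) → f.det = 0 := by
    intro H
    refine det_eq_zero_of_mul_eq_zero hG ?_
    ext j k
    have h1 := H j k
    simp only [mul_left_comm _ (u i), ← Finset.mul_sum] at h1
    exact (mul_eq_zero.1 h1).resolve_left hi
  have right : (∀ j k, ∑ l, G j l * (u i * f k l) = 0) → f.det = 0 := by
    intro H
    rw [← Matrix.det_transpose]
    refine det_eq_zero_of_mul_eq_zero hG ?_
    ext j k
    have h1 := H j k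
    simp only [mul_left_comm _ (u i), ← Finset.mul_sum] at h1
    exact (mul_eq_zero.1 h1).resolve_left hi
  fin_cases p <;> fin_cases q <;> first | exact absurd rfl hpq | skip
  · exact left fun j k => hs (i, j, k)
  · exact right fun j k => hs (i, k, j)
  · exact left fun j k => hs (j, i, k)
  · exact right fun j k => hs (k, i, j)
  · exact left fun j k => hs (j, k, i)
  · exact right fun j k => hs (k, j, i)

/-- The vector orthogonal to `u` is an eigenvector of the Hermitian `R` with eigenvalue `R.trace`,
and the adjugate is `R.trace • 1 - R`. -/
theorem exists_orthogonal_annihilated {R : Matrix (Fin 2) (Fin 2) ℂ} (hR : R.IsHermitian)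
    (hd : R.det = 0) :
    ∃ u : Fin 2 → ℂ, u ≠ 0 ∧ R.mulVec u = 0 ∧
      R.adjugate.mulVec ![-star (u 1), star (u 0)] = 0 := by
  obtain ⟨u, hu, hRu⟩ := Matrix.exists_mulVec_eq_zero_iff.2 hd
  refine ⟨u, hu, hRu, ?_⟩
  have h : ∀ i, star (R i 0) * star (u 0) + star (R i 1) * star (u 1) = 0 := by
    intro i
    have h1 := congrArg star (congrFun hRu i)
    simpa [Matrix.mulVec, dotProduct, Fin.sum_univ_two] using h1
  simp only [hR.apply] at h
  rw [Matrix.adjugate_fin_two]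
  have h0 := h 0
  have h1 := h 1
  ext i
  fin_cases i <;> simp at h0 h1 ⊢
  · linear_combination -h1
  · linear_combination h0

end TriState

/-! ### Equations of the span and of its orthogonal complement -/

namespace ThreeQubit

/-- Cramer's rule for a homogeneous system of three equations in four unknowns that form a
singular matrix. -/
theorem cramer_minors {f : Matrix (Fin 2) (Fin 2) ℂ} (hf : f ≠ 0) (hd : f.det = 0)
    {p₀ p₁ p₂ p₃ q₀ q₁ q₂ q₃ r₀ r₁ r₂ r₃ : ℂ}
    (hp : p₀ * f 0 0 + p₁ * f 0 1 + p₂ * f 1 0 + p₃ * f 1 1 = 0)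
    (hq : q₀ * f 0 0 + q₁ * f 0 1 + q₂ * f 1 0 + q₃ * f 1 1 = 0)
    (hr : r₀ * f 0 0 + r₁ * f 0 1 + r₂ * f 1 0 + r₃ * f 1 1 = 0) :
    (p₁ * (q₂ * r₃ - q₃ * r₂) - p₂ * (q₁ * r₃ - q₃ * r₁) + p₃ * (q₁ * r₂ - q₂ * r₁)) *
      (p₀ * (q₁ * r₂ - q₂ * r₁) - p₁ * (q₀ * r₂ - q₂ * r₀) + p₂ * (q₀ * r₁ - q₁ * r₀)) -
    (p₀ * (q₂ * r₃ - q₃ * r₂) - p₂ * (q₀ * r₃ - q₃ * r₀) + p₃ * (q₀ * r₂ - q₂ * r₀)) *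
      (p₀ * (q₁ * r₃ - q₃ * r₁) - p₁ * (q₀ * r₃ - q₃ * r₀) + p₃ * (q₀ * r₁ - q₁ * r₀)) = 0 := by
  rw [Matrix.det_fin_two] at hd
  set m₀ := p₁ * (q₂ * r₃ - q₃ * r₂) - p₂ * (q₁ * r₃ - q₃ * r₁) + p₃ * (q₁ * r₂ - q₂ * r₁)
    with hm₀
  set m₁ := p₀ * (q₂ * r₃ - q₃ * r₂) - p₂ * (q₀ * r₃ - q₃ * r₀) + p₃ * (q₀ * r₂ - q₂ * r₀)
    with hm₁
  set m₂ := p₀ * (q₁ * r₃ - q₃ * r₁) - p₁ * (q₀ * r₃ - q₃ * r₀) + p₃ * (q₀ * r₁ - q₁ * r₀)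
    with hm₂
  set m₃ := p₀ * (q₁ * r₂ - q₂ * r₁) - p₁ * (q₀ * r₂ - q₂ * r₀) + p₂ * (q₀ * r₁ - q₁ * r₀)
    with hm₃
  -- The entries of `f` are proportional to the signed minors `(m₀, -m₁, m₂, -m₃)`. The cross
  -- relations hold without any rank assumption.
  have h01 : m₀ * f 0 1 = -m₁ * f 0 0 := by
    linear_combination (q₂ * r₃ - q₃ * r₂) * hp - (p₂ * r₃ - p₃ * r₂) * hq +
      (p₂ * q₃ - p₃ * q₂) * hr
  have h02 : m₀ * f 1 0 = m₂ * f 0 0 := by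
    linear_combination -(q₁ * r₃ - q₃ * r₁) * hp + (p₁ * r₃ - p₃ * r₁) * hq -
      (p₁ * q₃ - p₃ * q₁) * hr
  have h03 : m₀ * f 1 1 = -m₃ * f 0 0 := by
    linear_combination (q₁ * r₂ - q₂ * r₁) * hp - (p₁ * r₂ - p₂ * r₁) * hq +
      (p₁ * q₂ - p₂ * q₁) * hr
  have h12 : m₁ * f 1 0 = -m₂ * f 0 1 := by
    linear_combination -(q₀ * r₃ - q₃ * r₀) * hp + (p₀ * r₃ - p₃ * r₀) * hq -
      (p₀ * q₃ - p₃ * q₀) * hr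
  have h13 : m₁ * f 1 1 = m₃ * f 0 1 := by
    linear_combination (q₀ * r₂ - q₂ * r₀) * hp - (p₀ * r₂ - p₂ * r₀) * hq +
      (p₀ * q₂ - p₂ * q₀) * hr
  have h23 : m₂ * f 1 1 = -m₃ * f 1 0 := by
    linear_combination (q₀ * r₁ - q₁ * r₀) * hp - (p₀ * r₁ - p₁ * r₀) * hq +
      (p₀ * q₁ - p₁ * q₀) * hr
  clear_value m₀ m₁ m₂ m₃
  by_contra hne
  refine hf ?_
  -- By proportionality, the determinant of the minors times the square of any entry of `f` is a
  -- multiple of `f.det`.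
  have sq : ∀ x : ℂ, (m₀ * m₃ - m₁ * m₂) * x ^ 2 = 0 → x = 0 := fun x hx =>
    pow_eq_zero_iff (by norm_num) |>.1 ((mul_eq_zero.1 hx).resolve_left hne)
  have e0 : f 0 0 = 0 := sq _ (by grind)
  have e1 : f 0 1 = 0 := sq _ (by grind)
  have e2 : f 1 0 = 0 := sq _ (by grind)
  have e3 : f 1 1 = 0 := sq _ (by grind)
  ext i j
  fin_cases i <;> fin_cases j <;> assumption

/-- The linear equations of the span of `UBB`. -/
theorem equations_of_mem_span {ψ : TriState 2 2 2} (h : ψ ∈ Submodule.span ℂ UBB) :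
    ψ (0, 0, 1) + ψ (1, 0, 1) = ψ (1, 1, 0) + ψ (1, 1, 1) ∧
    3 * ψ (0, 0, 0) - 3 * ψ (0, 1, 1) + 2 * ψ (1, 0, 0) + ψ (1, 0, 1) - ψ (1, 1, 0) = 0 ∧
    3 * ψ (0, 1, 0) + 6 * ψ (0, 1, 1) + ψ (1, 0, 0) + 5 * ψ (1, 0, 1) - 5 * ψ (1, 1, 0) = 0 := by
  induction h using Submodule.span_induction with
  | mem x hx =>
    simp only [UBB, Set.mem_insert_iff, Set.mem_singleton_iff] at hx
    rcases hx with rfl | rfl | rfl | rfl | rfl <;>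
      simp [phi0, phi1, psi0, psi1, kappa, ket, Fin.sum_univ_two] <;> norm_num
  | zero => simp
  | add x y _ _ hx hy =>
    simp only [PiLp.add_apply]
    refine ⟨?_, ?_, ?_⟩
    · linear_combination hx.1 + hy.1
    · linear_combination hx.2.1 + hy.2.1
    · linear_combination hx.2.2 + hy.2.2
  | smul r x _ hx =>
    simp only [PiLp.smul_apply, smul_eq_mul]
    refine ⟨?_, ?_, ?_⟩
    · linear_combination r * hx.1
    · linear_combination r * hx.2.1
    · linear_combination r * hx.2.2

/-- For fixed `u` the three equations of the span are linear in `f`, with coefficients linear in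
`u`. The minors are cubics in `u`, and singularity of `f` is a quadratic condition on them: a
sextic, up to the factor `-9` or `-18`. -/
theorem sextic_eq_zero {p : Fin 3} {u : Fin 2 → ℂ} {f : Matrix (Fin 2) (Fin 2) ℂ}
    (hf : f ≠ 0) (hd : f.det = 0) (h : biproduct p u f ∈ Submodule.span ℂ UBB) :
    sextic p u = 0 := by
  obtain ⟨e1, e2, e3⟩ := equations_of_mem_span h
  fin_cases p
  · simp [biproduct] at e1 e2 e3
    have := cramer_minors hf hd (p₀ := 0) (p₁ := u 0 + u 1) (p₂ := -u 1) (p₃ := -u 1)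
      (q₀ := 3 * u 0 + 2 * u 1) (q₁ := u 1) (q₂ := -u 1) (q₃ := -3 * u 0)
      (r₀ := u 1) (r₁ := 5 * u 1) (r₂ := 3 * u 0 - 5 * u 1) (r₃ := 6 * u 0)
      (by linear_combination e1) (by linear_combination e2) (by linear_combination e3)
    simp only [sextic, Fin.zero_eta, Matrix.cons_val]
    linear_combination -this / 9
  · simp [biproduct] at e1 e2 e3
    have := cramer_minors hf hd (p₀ := 0) (p₁ := u 0) (p₂ := -u 1) (p₃ := u 0 - u 1)
      (q₀ := 3 * u 0) (q₁ := -3 * u 1) (q₂ := 2 * u 0 - u 1) (q₃ := u 0)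
      (r₀ := 3 * u 1) (r₁ := 6 * u 1) (r₂ := u 0 - 5 * u 1) (r₃ := 5 * u 0)
      (by linear_combination e1) (by linear_combination e2) (by linear_combination e3)
    simp only [sextic, Fin.mk_one, Matrix.cons_val]
    linear_combination -this / 18
  · simp [biproduct] at e1 e2 e3
    have := cramer_minors hf hd (p₀ := u 1) (p₁ := 0) (p₂ := u 1) (p₃ := -u 0 - u 1)
      (q₀ := 3 * u 0) (q₁ := -3 * u 1) (q₂ := 2 * u 0 + u 1) (q₃ := -u 0)
      (r₀ := 0) (r₁ := 3 * u 0 + 6 * u 1) (r₂ := u 0 + 5 * u 1) (r₃ := -5 * u 0)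
      (by linear_combination e1) (by linear_combination e2) (by linear_combination e3)
    simp only [sextic, Fin.reduceFinMk, Matrix.cons_val]
    linear_combination -this / 9

theorem star_sextic (p : Fin 3) (u : Fin 2 → ℂ) : star (sextic p u) = sextic p (star u) := by
  fin_cases p <;> simp [sextic]

/-- Here `s, t, q, w` are the amplitudes at `000, 010, 001, 101` that remain after elimination by
orthogonality, and `(r₀, r₁)` is a nonzero row of the annihilator. -/
theorem biseparable_system_A {s t q w r₀ r₁ : ℂ} (hr : r₀ ≠ 0 ∨ r₁ ≠ 0)
    (h : 3 * (w - q) = 5 * t + s) (h₁ : 3 * r₀ * s + r₁ * (t + 2 * s) = 0)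
    (h₂ : r₀ * q + r₁ * w = 0) (h₃ : r₀ * t - r₁ * w = 0) (h₄ : r₀ * (2 * t - s) - r₁ * q = 0) :
    s = 0 ∧ t = 0 ∧ q = 0 ∧ w = 0 := by
  by_cases h1 : r₁ = 0
  · grind
  · have : t = 0 := by grind
    grind

theorem biseparable_system_B {s t q w r₀ r₁ : ℂ} (hr : r₀ ≠ 0 ∨ r₁ ≠ 0)
    (h : 3 * (w - q) = 5 * t + s) (h₁ : r₀ * s + r₁ * t = 0)
    (h₂ : r₀ * q + r₁ * (2 * t - s) = 0) (h₃ : r₀ * (t + 2 * s) - 3 * r₁ * w = 0)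
    (h₄ : r₀ * w - r₁ * q = 0) :
    s = 0 ∧ t = 0 ∧ q = 0 ∧ w = 0 := by
  by_cases h1 : r₀ = 0
  · grind
  · have : t = 0 := by grind
    grind

theorem biseparable_system_C {s t q w r₀ r₁ : ℂ} (hr : r₀ ≠ 0 ∨ r₁ ≠ 0)
    (h : 3 * (w - q) = 5 * t + s) (h₁ : r₀ * s + r₁ * q = 0)
    (h₂ : r₀ * t + r₁ * (2 * t - s) = 0) (h₃ : r₀ * (t + 2 * s) + 3 * r₁ * w = 0)
    (h₄ : r₀ * w + r₁ * q = 0) :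
    s = 0 ∧ t = 0 ∧ q = 0 ∧ w = 0 := by
  by_cases h1 : r₁ = 0
  · grind
  · have : t = 0 := by grind
    grind

theorem equations_of_orthogonal {χ : TriState 2 2 2}
    (h : ∀ v ∈ Submodule.span ℂ UBB, inner ℂ v χ = (0 : ℂ)) :
    χ (0, 0, 0) - 2 * χ (0, 1, 0) + χ (0, 1, 1) = 0 ∧
    χ (0, 1, 0) + 2 * χ (0, 0, 0) - 3 * χ (1, 0, 0) = 0 ∧
    χ (1, 0, 1) + χ (1, 1, 0) = 0 ∧ χ (0, 0, 1) + χ (1, 1, 1) = 0 ∧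
    χ (0, 0, 0) + χ (0, 1, 0) + χ (1, 0, 0) + χ (1, 1, 0) + χ (0, 0, 1) + χ (0, 1, 1) -
      χ (1, 0, 1) - χ (1, 1, 1) = 0 := by
  have h0 := h phi0 (Submodule.subset_span (by simp [UBB]))
  have h1 := h phi1 (Submodule.subset_span (by simp [UBB]))
  have h2 := h psi0 (Submodule.subset_span (by simp [UBB]))
  have h3 := h psi1 (Submodule.subset_span (by simp [UBB]))
  have h4 := h kappa (Submodule.subset_span (by simp [UBB]))
  simp [phi0, phi1, psi0, psi1, kappa, ket, Fin.sum_univ_two,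
    EuclideanSpace.inner_single_left] at h0 h1 h2 h3 h4
  refine ⟨?_, ?_, h2, h3, ?_⟩
  · linear_combination h0
  · linear_combination h1
  · linear_combination h4

/-- The orthogonal complement of the span of `UBB` contains no biseparable vector. -/
theorem eq_zero_of_orthogonal_of_localOp_eq_zero {p : Fin 3} {G : Matrix (Fin 2) (Fin 2) ℂ}
    (hG : G ≠ 0) {χ : TriState 2 2 2}
    (h : ∀ v ∈ Submodule.span ℂ UBB, inner ℂ v χ = (0 : ℂ)) (hχ : localOp p G χ = 0) :
    χ = 0 := by
  obtain ⟨e0, e1, e2, e3, e4⟩ := equations_of_orthogonal h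
  obtain ⟨a, ha⟩ : ∃ a, G a ≠ 0 := Function.ne_iff.1 hG
  have ha' : G a 0 ≠ 0 ∨ G a 1 ≠ 0 := by
    by_contra! H
    exact ha (by ext b; fin_cases b; exacts [H.1, H.2])
  have hs : ∀ s, localOp p G χ s = 0 := fun s => by rw [hχ]; rfl
  -- One nonzero row of `G` suffices: it annihilates each slice of `χ` along party `p`.
  have main : ∀ j k : Fin 2, G a 0 * χ (![(0, j, k), (j, 0, k), (j, k, 0)] p) +
      G a 1 * χ (![(1, j, k), (j, 1, k), (j, k, 1)] p) = 0 := by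
    intro j k
    have h1 := hs (![(a, j, k), (j, a, k), (j, k, a)] p)
    fin_cases p <;>
      simpa [localOp_zero, localOp_one, localOp_two, applyA, applyB, applyC, Fin.sum_univ_two]
        using h1
  have m00 := main 0 0
  have m01 := main 0 1
  have m10 := main 1 0
  have m11 := main 1 1
  clear main hs hχ h
  generalize G a 0 = r₀ at *
  generalize G a 1 = r₁ at *
  have f011 : χ (0, 1, 1) = 2 * χ (0, 1, 0) - χ (0, 0, 0) := by linear_combination e0
  have f100 : χ (1, 0, 0) = (χ (0, 1, 0) + 2 * χ (0, 0, 0)) / 3 := by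
    linear_combination -e1 / 3
  have f110 : χ (1, 1, 0) = -χ (1, 0, 1) := by linear_combination e2
  have f111 : χ (1, 1, 1) = -χ (0, 0, 1) := by linear_combination e3
  have f : 3 * (χ (1, 0, 1) - χ (0, 0, 1)) = 5 * χ (0, 1, 0) + χ (0, 0, 0) := by
    rw [f011, f100, f110, f111] at e4
    linear_combination -3 / 2 * e4
  obtain ⟨z1, z2, z3, z4⟩ :
      χ (0, 0, 0) = 0 ∧ χ (0, 1, 0) = 0 ∧ χ (0, 0, 1) = 0 ∧ χ (1, 0, 1) = 0 := by
    fin_cases p <;> simp [f011, f100, f110, f111] at m00 m01 m10 m11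
    · exact biseparable_system_A ha' f (by linear_combination 3 * m00) m01
        (by linear_combination m10) (by linear_combination m11)
    · exact biseparable_system_B ha' f m00 m01 (by linear_combination 3 * m10)
        (by linear_combination m11)
    · exact biseparable_system_C ha' f m00 m01 (by linear_combination 3 * m10)
        (by linear_combination -m11)
  rw [z1, z2] at f011 f100
  rw [z4] at f110
  rw [z3] at f111
  norm_num at f011 f100 f110 f111
  ext ⟨i, j, k⟩
  fin_cases i <;> fin_cases j <;> fin_cases k <;> assumption

end ThreeQubit

/-! ### Conclusion -/

open ThreeQubit

theorem finrank_span_UBB : 5 ≤ Module.finrank ℂ (Submodule.span ℂ UBB) := by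
  have h : LinearIndependent ℂ ![phi0, phi1, psi0, psi1, kappa] := by
    rw [Fintype.linearIndependent_iff]
    intro g hg
    have hs : ∀ s, (∑ i, g i • ![phi0, phi1, psi0, psi1, kappa] i) s = 0 := fun s => by
      rw [hg]; rfl
    have h1 := hs (0, 1, 1)
    have h2 := hs (1, 0, 0)
    have h3 := hs (1, 0, 1)
    have h4 := hs (0, 0, 1)
    have h5 := hs (0, 0, 0)
    simp [Fin.sum_univ_succ, phi0, phi1, psi0, psi1, kappa, ket] at h1 h2 h3 h4 h5
    have z1 : g 1 = 0 := by linear_combination (h5 - h1) / 2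
    have z4 : g 4 = 0 := by linear_combination h2 + 3 * z1
    have z0 : g 0 = 0 := by linear_combination h1 - z4
    have z2 : g 2 = 0 := by linear_combination h3 + z4
    have z3 : g 3 = 0 := by linear_combination h4 - z4
    intro i
    fin_cases i
    exacts [z0, z1, z2, z3, z4]
  have h1 := finrank_span_eq_card h
  have h2 : Submodule.span ℂ (Set.range ![phi0, phi1, psi0, psi1, kappa])
      ≤ Submodule.span ℂ UBB := by
    refine Submodule.span_mono ?_
    rintro _ ⟨i, rfl⟩
    fin_cases i <;> simp [UBB]
  have h3 := Submodule.finrank_mono h2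
  rw [h1, Fintype.card_fin] at h3
  exact h3

theorem proposition5 :
    IsLocallyIndistinguishable (Submodule.span ℂ ThreeQubit.UBB) := by
  rintro n ψ hψ ⟨P, hP⟩
  have hn : 5 ≤ n := by
    have h1 := finrank_span_UBB
    rw [← hψ.span_eq] at h1
    exact h1.trans ((finrank_range_le_card ψ).trans (Fintype.card_fin n).le)
  have hmem : ∀ i, ψ i ∈ Submodule.span ℂ UBB := fun i =>
    hψ.span_eq ▸ Submodule.subset_span ⟨i, rfl⟩
  have hbisep : UnextendibleBiseparably ψ := by
    intro p G hG χ hχ h0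
    refine eq_zero_of_orthogonal_of_localOp_eq_zero hG (fun v hv => ?_) h0
    rw [← hψ.span_eq] at hv
    induction hv using Submodule.span_induction with
    | mem x hx => obtain ⟨i, rfl⟩ := hx; exact hχ i
    | zero => exact inner_zero_left _
    | add x y _ _ hx hy => rw [inner_add_left, hx, hy, add_zero]
    | smul r x _ hx => rw [inner_smul_left, hx, mul_zero]
  -- The accumulated operators start as identities.
  have hD := LOCCProtocol.PerfectlyDistinguishes.distinguishing (ψ := ψ) P 1 1 1 (by
    simpa only [one_applyA, one_applyB, one_applyC] using hP)
  obtain ⟨p, R, hRh, hR0, hRd, k, l, hk, hl, ⟨q, hpq, G, hG, hGk⟩, ⟨q', hpq', G', hG', hGl⟩⟩ :=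
    hD.exists_product_pair hbisep hψ.ne_zero hψ.orthogonal hn fun q =>
      ⟨1, one_ne_zero, by fin_cases q <;> simp⟩
  obtain ⟨u, hu, hRu, hRu'⟩ := exists_orthogonal_annihilated hRh hRd
  have hv : ![-star (u 1), star (u 0)] ≠ 0 := by
    intro h
    refine hu ?_
    have h0 := congrFun h 0
    have h1 := congrFun h 1
    ext i
    fin_cases i
    · simpa using h1
    · simpa using h0
  have zero : ∀ {v : Fin 2 → ℂ} {S : Matrix (Fin 2) (Fin 2) ℂ} {i : Fin n} {q : Fin 3}
      {G : Matrix (Fin 2) (Fin 2) ℂ}, S ≠ 0 → v ≠ 0 → S.mulVec v = 0 → localOp p S (ψ i) = 0 →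
      p ≠ q → G ≠ 0 → localOp q G (ψ i) = 0 → sextic p v = 0 := by
    intro v S i q G hS hv hSv hi hpq hG hGi
    obtain ⟨f, hf⟩ := exists_eq_biproduct hS hv hSv hi
    have hf0 : f ≠ 0 := by
      rintro rfl
      exact hψ.ne_zero i (by rw [hf, biproduct_zero])
    refine sextic_eq_zero hf0 ?_ (hf ▸ hmem i)
    rw [hf] at hGi
    exact det_eq_zero_of_localOp_biproduct_eq_zero hpq hv hG hGi
  have s1 := zero hR0 hu hRu hk hpq hG hGk
  have s2 := zero (adjugate_ne_zero_fin_two hR0) hv hRu' hl hpq' hG' hGl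
  -- Real coefficients allow the complex conjugation in the orthogonal vector to be removed.
  have s3 : sextic p ![-u 1, u 0] = 0 := by
    have h := congrArg star s2
    rw [star_sextic, star_zero] at h
    rw [← h]
    congr 1
    ext i
    fin_cases i <;> simp
  -- Rotating twice gives `-u`, and the degree is even; so the coprimality lemma also applies to the
  -- rotated vector and yields the other coordinate.
  have s4 : sextic p ![-(u 0), -(u 1)] = 0 := by
    rw [← s1]
    fin_cases p <;> simp [sextic] <;> ring
  have u0 := eq_zero_of_sextic_eq_zero p u s1 s3
  have u1 := eq_zero_of_sextic_eq_zero p ![-u 1, u 0] s3 (by simpa using s4)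
  refine hu ?_
  ext i
  fin_cases i
  · exact u0
  · simpa using u1
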